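/- A compact nilmanifold is a quotient $G/\Gamma$ of a simply connected nilpotent Lie group by a discrete cocompact subgroup; an affine automorphism of $G/\Gamma$ is a map $x\Gamma\mapsto g\,A(x)\Gamma$ with $g\in G$ and $A$ a Lie group automorphism of $G$ with $A(\Gamma)=\Gamma$. A compact infranilmanifold is a manifold finitely covered by a compact nilmanifold, and an affine automorphism of it is a map that lifts to an affine automorphism of a finite cover by a nilmanifold. Let $M,N$ be compact connected smooth manifolds, $M$ an infranilmanifold, and let $\alpha$ be an action of $\mathbb Z^k$ on $M$ by affine automorphisms, some element of which is an Anosov diffeomorphism. Let $x_0\in M$ be a fixed point of $\alpha$ and $p:(\hat M,\hat x_0)\to(M,x_0)$ the universal covering. Let $\beta:\mathbb Z^k\times M\to \mathrm{Diff}^1(N)$ be a $C^1$ cocycle over $\alpha$, i.e. $\beta(a+b,x)=\beta(a,\alpha(b)x)\,\beta(b,x)$ and $(x,y)\mapsto\beta(a,x)y$ is $C^1$ for every $a$, with $\beta(a,x_0)=\mathrm{id}$ for all $a$, and let $\tilde\alpha(a)(x,y)=(\alpha(a)x,\beta(a,x)y)$ be the extended action on $M\times N$. Let $1\le n\le\infty$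 and let $\mathcal W_H$ be a horizontal $\tilde\alpha$-invariant $C^n$ foliation of $M\times N$, i.e. one with leaves of dimension $\dim M$, transverse to the fibers $\{x\}\times N$, and whose tangent distribution is invariant under all $D\tilde\alpha(a)$. Let $\hat{\mathcal W}_H$ be its lift to $\hat M\times N$. Then for all $\hat x\in\hat M$ and $y\in N$ the leaf of $\hat{\mathcal W}_H$ through $(\hat x_0,y)$ meets $\{\hat x\}\times N$ in exactly one point $(\hat x,h(\hat x)y)$, $h(\hat x)$ is a $C^n$ diffeomorphism of $N$, and, with $\pi_1(M,x_0)$ acting on $\hat M$ by deck transformations, $H(\omega)=h(\hat x)^{-1}\circ h(\omega\cdot\hat x)$ does not depend on $\hat x$ and defines a group homomorphism $H:\pi_1(M,x_0)\to\mathrm{Diff}^n(N)$ (the product in $\pi_1$ being ordered so that $\omega\eta$ is $\eta$ followed by $\omega$). Let $K\subset\pi_1(M,x_0)$ be the subgroup generated by all $\alpha(a)_*\omega\cdot\omega^{-1}$, $a\in\mathbb Z^k$, $\omega\in\pi_1(M,x_0)$; it is normal. Moreover: 1. $H(\alpha(a)_*\omega)=H(\omega)$ for all $a\in\mathbb Z^k$,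 $\omega\in\pi_1(M,x_0)$; hence $H$ induces a group homomorphism $\bar H:\pi_1(M,x_0)/K\to\mathrm{Diff}^n(N)$. 2. $K$ has finite index in $\pi_1(M,x_0)$. -/

import Mathlib

open scoped Manifold ContDiff Topology

/-! ### Diffeomorphism groups -/

/-- The group of `C^n` diffeomorphisms of a manifold `X`, as a group of permutations of `X`. -/
def Diff {E H : Type*} [NormedAddCommGroup E] [NormedSpace ℝ E] [TopologicalSpace H]
    (I : ModelWithCorners ℝ E H) (n : WithTop ℕ∞) (X : Type*) [TopologicalSpace X]
    [ChartedSpace H X] :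
    Subgroup (Equiv.Perm X) where
  carrier := {f | ContMDiff I I n f ∧ ContMDiff I I n f.symm}
  mul_mem' := fun {_ _} hf hg => ⟨hf.1.comp hg.1, hg.2.comp hf.2⟩
  one_mem' := ⟨contMDiff_id, contMDiff_id⟩
  inv_mem' := fun {_} hf => ⟨hf.2, hf.1⟩

/-- A diffeomorphism as a continuous map. -/
def Diff.toContinuousMap {E H : Type*} [NormedAddCommGroup E] [NormedSpace ℝ E]
    [TopologicalSpace H] {I : ModelWithCorners ℝ E H} {n : WithTop ℕ∞} {X : Type*} [TopologicalSpace X]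
    [ChartedSpace H X] (f : Diff I n X) : C(X, X) :=
  ⟨f.1, f.2.1.continuous⟩

/-- The group `ℤ^k`, written multiplicatively. -/
abbrev IntLattice (k : ℕ) : Type := Multiplicative (Fin k → ℤ)

/-! ### Anosov diffeomorphisms -/

/-- `f` is Anosov: for some Riemannian metric there are a `Df`-invariant splitting
`TM = Es ⊕ Eu` into nontrivial subbundles and some `l ≥ 1` such that `‖Df^l v‖ < 1` for unit
vectors `v ∈ Es` and `1 < ‖Df^l v‖` for unit vectors `v ∈ Eu`. -/
def IsAnosov {m : ℕ} {M : Type*} [TopologicalSpace M] [ChartedSpace (EuclideanSpace ℝ (Fin m)) M]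
    [IsManifold (𝓡 m) ∞ M] (f : M → M) : Prop :=
  ∃ (g : Bundle.ContMDiffRiemannianMetric (𝓡 m) ∞ (EuclideanSpace ℝ (Fin m))
        (fun x : M => TangentSpace (𝓡 m) x))
    (Es Eu : ∀ x : M, Submodule ℝ (TangentSpace (𝓡 m) x)),
    (∀ x, IsCompl (Es x) (Eu x)) ∧
    (∀ x, Es x ≠ ⊥) ∧ (∀ x, Eu x ≠ ⊥) ∧
    (∀ x, (Es x).map (mfderiv (𝓡 m) (𝓡 m) f x).toLinearMap = Es (f x)) ∧
    (∀ x, (Eu x).map (mfderiv (𝓡 m) (𝓡 m) f x).toLinearMap = Eu (f x)) ∧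
    ∃ l : ℕ, 1 ≤ l ∧ ∀ x,
      (∀ v ∈ Es x, g.inner x v v = 1 →
        g.inner (f^[l] x) (mfderiv (𝓡 m) (𝓡 m) (f^[l]) x v)
          (mfderiv (𝓡 m) (𝓡 m) (f^[l]) x v) < 1) ∧
      (∀ v ∈ Eu x, g.inner x v v = 1 →
        1 < g.inner (f^[l] x) (mfderiv (𝓡 m) (𝓡 m) (f^[l]) x v)
          (mfderiv (𝓡 m) (𝓡 m) (f^[l]) x v))

/-! ### Infranilmanifolds and their affine automorphisms -/

/-- A finite covering `p : G ⧸ Γ → M` of `M` by a compact nilmanifold: `G` is a simply connected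
nilpotent Lie group and `Γ` a discrete cocompact subgroup. As `G → G ⧸ Γ` is a local
diffeomorphism, smoothness of the covering is expressed on `G`. -/
structure NilmanifoldCover (m : ℕ) (M : Type*) [TopologicalSpace M]
    [ChartedSpace (EuclideanSpace ℝ (Fin m)) M] where
  /-- the Lie group -/
  G : Type
  [group : Group G]
  [topology : TopologicalSpace G]
  [charts : ChartedSpace (EuclideanSpace ℝ (Fin m)) G]
  [lie : LieGroup (𝓡 m) ∞ G]
  [t2 : T2Space G]
  [simplyConnected : SimplyConnectedSpace G]
  [nilpotent : Group.IsNilpotent G]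
  /-- the lattice -/
  Γ : Subgroup G
  discrete : DiscreteTopology Γ
  cocompact : CompactSpace (G ⧸ Γ)
  /-- the covering map -/
  p : G ⧸ Γ → M
  isCoveringMap : IsCoveringMap p
  surjective : Function.Surjective p
  finite_fiber : ∀ x, (p ⁻¹' {x}).Finite
  isLocalDiffeomorph : IsLocalDiffeomorph (𝓡 m) (𝓡 m) ∞ (fun x : G => p (x : G ⧸ Γ))

attribute [instance] NilmanifoldCover.group NilmanifoldCover.topology NilmanifoldCover.charts
  NilmanifoldCover.lie NilmanifoldCover.t2 NilmanifoldCover.simplyConnected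
  NilmanifoldCover.nilpotent

/-- `M` is an infranilmanifold: it is finitely covered by a compact nilmanifold. -/
def IsInfranilmanifold (m : ℕ) (M : Type*) [TopologicalSpace M]
    [ChartedSpace (EuclideanSpace ℝ (Fin m)) M] : Prop :=
  Nonempty (NilmanifoldCover m M)

/-- `f` is an affine automorphism of the infranilmanifold `M`: it lifts, on a finite cover
`G ⧸ Γ`, to an affine automorphism `xΓ ↦ g A(x) Γ`, where `A` is an automorphism of the Lie group
`G` with `A(Γ) = Γ` and `g ∈ G`. -/
def IsAffineAutomorphism (m : ℕ) {M : Type*} [TopologicalSpace M]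
    [ChartedSpace (EuclideanSpace ℝ (Fin m)) M] (f : M → M) : Prop :=
  ∃ (C : NilmanifoldCover m M) (A : C.G ≃ₜ* C.G) (g : C.G),
    C.Γ.map (A : C.G →* C.G) = C.Γ ∧
    ∀ x : C.G, f (C.p (x : C.G ⧸ C.Γ)) = C.p ((g * A x : C.G) : C.G ⧸ C.Γ)

/-! ### Cocycles with values in diffeomorphism groups -/

/-- `β` is a `C^1` cocycle over `α` with values in the `C^1` diffeomorphisms of `N`. -/
structure IsCocycle {k m q : ℕ} {M N : Type*}
    [TopologicalSpace M] [ChartedSpace (EuclideanSpace ℝ (Fin m)) M]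
    [TopologicalSpace N] [ChartedSpace (EuclideanSpace ℝ (Fin q)) N]
    (α : IntLattice k →* Diff (𝓡 m) ∞ M) (β : IntLattice k → M → Diff (𝓡 q) 1 N) : Prop where
  map_mul : ∀ a b x, β (a * b) x = β a ((α b).1 x) * β b x
  contMDiff : ∀ a, ContMDiff ((𝓡 m).prod (𝓡 q)) (𝓡 q) 1 (fun z : M × N => (β a z.1).1 z.2)

/-- The extension `(x, y) ↦ (α(a) x, β(a, x) y)` of `α(a)` to `M × N`. -/
noncomputable def extension {k m q : ℕ} {M N : Type*}
    [TopologicalSpace M] [ChartedSpace (EuclideanSpace ℝ (Fin m)) M]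
    [TopologicalSpace N] [ChartedSpace (EuclideanSpace ℝ (Fin q)) N]
    (α : IntLattice k →* Diff (𝓡 m) ∞ M) (β : IntLattice k → M → Diff (𝓡 q) 1 N) (a : IntLattice k)
    (z : M × N) : M × N :=
  ((α a).1 z.1, (β a z.1).1 z.2)

/-! ### Foliations -/

/-- A `C^n` foliation of `X` with leaves of dimension `d` and codimension `c`, given by an atlas of
foliated charts onto `D^d × D^c`; the plaques are the preimages of the disks `D^d × {y}`, and the
plaques of any two charts coincide locally. -/
structure Foliation {E H : Type*} [NormedAddCommGroup E] [NormedSpace ℝ E] [TopologicalSpace H]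
    (I : ModelWithCorners ℝ E H) (n : ℕ∞) (d c : ℕ) (X : Type*) [TopologicalSpace X]
    [ChartedSpace H X] where
  /-- the foliated charts -/
  atlas : Set (OpenPartialHomeomorph X (EuclideanSpace ℝ (Fin d) × EuclideanSpace ℝ (Fin c)))
  covers : ∀ z, ∃ φ ∈ atlas, z ∈ φ.source
  target_eq : ∀ φ ∈ atlas, φ.target = Metric.ball 0 1 ×ˢ Metric.ball 0 1
  contMDiffOn : ∀ φ ∈ atlas,
    ContMDiffOn I 𝓘(ℝ, EuclideanSpace ℝ (Fin d) × EuclideanSpace ℝ (Fin c)) n φ φ.source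
  contMDiffOn_symm : ∀ φ ∈ atlas,
    ContMDiffOn 𝓘(ℝ, EuclideanSpace ℝ (Fin d) × EuclideanSpace ℝ (Fin c)) I n φ.symm φ.target
  compatible : ∀ φ ∈ atlas, ∀ ψ ∈ atlas, ∀ z ∈ φ.source ∩ ψ.source,
    ∃ U ∈ 𝓝 z, ∀ w ∈ U, ∀ w' ∈ U, (φ w).2 = (φ w').2 ↔ (ψ w).2 = (ψ w').2

namespace Foliation

variable {E H : Type*} [NormedAddCommGroup E] [NormedSpace ℝ E] [TopologicalSpace H]
  {I : ModelWithCorners ℝ E H} {n : ℕ∞} {d c : ℕ} {X : Type*} [TopologicalSpace X]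
  [ChartedSpace H X]

/-- The tangent space at `z` of the leaf through `z`. -/
noncomputable def tangent (W : Foliation I n d c X) (z : X) : Submodule ℝ (TangentSpace I z) :=
  ⨅ φ ∈ W.atlas, ⨅ _ : z ∈ φ.source,
    (mfderiv I 𝓘(ℝ, EuclideanSpace ℝ (Fin c)) (fun w => (φ w).2) z).ker

/-- The path `γ` runs in a leaf (and is continuous for the leaf topology, if it is continuous):
in every foliated chart its transverse coordinate is locally constant. -/
def IsLeafwise (W : Foliation I n d c X) (γ : unitInterval → X) : Prop :=
  ∀ φ ∈ W.atlas, ∀ t, γ t ∈ φ.source → ∀ᶠ s in 𝓝 t, (φ (γ s)).2 = (φ (γ t)).2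

/-- The foliation is invariant under `f`: the derivative of `f` maps its tangent distribution
onto itself. -/
def IsInvariant (W : Foliation I n d c X) (f : X → X) : Prop :=
  ∀ z, (W.tangent z).map (mfderiv I I f z).toLinearMap = W.tangent (f z)

end Foliation

/-- The foliation `W` of `M × N` is horizontal: it is transverse to the fibers `{x} × N`, with
leaves of the dimension of `M`. -/
def Foliation.IsHorizontal {m q : ℕ} {n : ℕ∞} {M N : Type*}
    [TopologicalSpace M] [ChartedSpace (EuclideanSpace ℝ (Fin m)) M]
    [TopologicalSpace N] [ChartedSpace (EuclideanSpace ℝ (Fin q)) N]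
    (W : Foliation ((𝓡 m).prod (𝓡 q)) n m q (M × N)) : Prop :=
  ∀ z, IsCompl (W.tangent z)
    (mfderiv ((𝓡 m).prod (𝓡 q)) (𝓡 m) (Prod.fst : M × N → M) z).ker

/-- The leaf through `z` of the lift of `W` to `M' × N`, where `p : M' → M` is a covering:
the set of endpoints of paths from `z` whose projections to `M × N` run in leaves of `W`. -/
def Foliation.liftedLeaf {m q : ℕ} {n : ℕ∞} {M N M' : Type*}
    [TopologicalSpace M] [ChartedSpace (EuclideanSpace ℝ (Fin m)) M]
    [TopologicalSpace N] [ChartedSpace (EuclideanSpace ℝ (Fin q)) N] [TopologicalSpace M']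
    (W : Foliation ((𝓡 m).prod (𝓡 q)) n m q (M × N)) (p : M' → M) (z : M' × N) :
    Set (M' × N) :=
  {z' | ∃ γ : Path z z', W.IsLeafwise (fun t => (p (γ t).1, (γ t).2))}

/-! ### The fundamental group -/

/-- The subgroup generated by the elements `f i σ * σ⁻¹`. -/
def displacementSubgroup {ι P : Type*} [Group P] (f : ι → P →* P) : Subgroup P :=
  Subgroup.closure {g | ∃ i σ, g = f i σ * σ⁻¹}

instance displacementSubgroup_normal {ι P : Type*} [Group P] (f : ι → P →* P) :
    (displacementSubgroup f).Normal := by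
  have key : ∀ i σ, f i σ * σ⁻¹ ∈ displacementSubgroup f := fun i σ =>
    Subgroup.subset_closure ⟨i, σ, rfl⟩
  refine ⟨fun x hx g => ?_⟩
  refine Subgroup.closure_induction
    (p := fun y _ => g * y * g⁻¹ ∈ displacementSubgroup f) ?_ ?_ ?_ ?_ hx
  · rintro _ ⟨i, σ, rfl⟩
    have h := mul_mem (inv_mem (key i g)) (key i (g * σ))
    simpa [mul_assoc] using h
  · simp
  · intro y z _ _ hy hz
    simpa [mul_assoc] using mul_mem hy hz
  · intro y _ hy
    simpa [mul_assoc] using inv_mem hy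

/-- The automorphism `α(a)_*` of `π₁(M, x₀)`, where `x₀` is a fixed point of the action `α`. -/
noncomputable def inducedMap {k m : ℕ} {M : Type*} [TopologicalSpace M]
    [ChartedSpace (EuclideanSpace ℝ (Fin m)) M] (α : IntLattice k →* Diff (𝓡 m) ∞ M) {x₀ : M}
    (hx₀ : ∀ a, (α a).1 x₀ = x₀) (a : IntLattice k) :
    FundamentalGroup M x₀ →* FundamentalGroup M x₀ :=
  FundamentalGroup.mapOfEq (Diff.toContinuousMap (α a)) (hx₀ a)

/-- `D` is the deck transformation of the universal covering `p` induced by `σ ∈ π₁(M, p x')`: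
it maps the base point `x'` to the endpoint of the lift of `σ` that starts at `x'`. -/
def IsDeckTransformation {M M' : Type*} [TopologicalSpace M] [TopologicalSpace M'] {p : M' → M}
    (hp : IsCoveringMap p) (x' : M') (σ : FundamentalGroup M (p x')) (D : M' ≃ₜ M') : Prop :=
  p ∘ D = p ∧ D x' = (hp.monodromy σ ⟨x', rfl⟩ : M')

/-! The projection to `M` of a leaf of a horizontal foliation is a local diffeomorphism, and since
`N` is compact, all leaves can be continued over a common neighborhood of each point of `M`. Over
the simply connected `M'` this yields a transport `Θ x₁ x₂` from the fiber over `x₁` to the fiber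
over `x₂`, unique because two leafwise sections over a connected base agree if they agree at a
point. Uniqueness makes `Θ` invariant under deck transformations, whence the holonomy
homomorphism, and equivariant under the lifts of the extended action; as the cocycle is trivial
over the fixed point, the holonomy is invariant under the action on the fundamental group.

For the finite index, let `f` be affine and Anosov with fixed point `x₀`. Up to passing to a
power, `f` is covered by an automorphism `B` of `G` that preserves `Γ`. The quotient of `Γ` by the
displacements of `B` is nilpotent and finitely generated, so it is finite unless it has a nonzero
homomorphism to `ℝ`. Such a homomorphism is a `B`-invariant `χ : Γ → ℝ`. Extend it to a function
on `G` that is equivariant for right translation by `Γ`, and average the increments of this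
function over `G ⧸ Γ`: this extends `χ` to a `B`-invariant homomorphism `X : G → ℝ`. The
derivative of `X` at `1` is a linear form invariant under a power of the hyperbolic derivative of
`f` at `x₀`, hence zero, so `X = 0` and `χ = 0`. -/

/-! ### Invariant means -/

section CommonFixedPoint

variable {E : Type*} [AddCommGroup E] [Module ℝ E] [TopologicalSpace E] [IsTopologicalAddGroup E]
  [ContinuousSMul ℝ E] [T2Space E] {S : Set E}

/- The Cesàro averages of an orbit are almost fixed, so any of their cluster points is fixed. -/
theorem exists_fixedPoint_of_isCompact_of_convex (T : E →L[ℝ] E) (hS : IsCompact S)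
    (hconv : Convex ℝ S) (hne : S.Nonempty) (hT : Set.MapsTo T S S) : ∃ x ∈ S, T x = x := by
  obtain ⟨x, hx⟩ := hne
  let average : ℕ → E := fun n => birkhoffAverage ℝ T id (n + 1) x
  have average_mem : ∀ n, average n ∈ S := fun n => by
    simp only [average, birkhoffAverage, birkhoffSum, Finset.smul_sum]
    refine hconv.sum_mem (fun _ _ => by positivity) ?_ fun i _ => hT.iterate i hx
    rw [Finset.sum_const, Finset.card_range, nsmul_eq_mul, mul_inv_cancel₀ (by positivity)]
  have map_average_sub : ∀ n,
      T (average n) - average n = ((n + 1 : ℕ) : ℝ)⁻¹ • (T^[n + 1] x - x) := fun n => by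
    have map_average : T (average n) = birkhoffAverage ℝ T id (n + 1) (T x) := by
      rw [map_birkhoffAverage ℝ ℝ]
      simp only [birkhoffAverage, birkhoffSum, Function.comp_id, id, ← Function.iterate_succ_apply,
        Function.iterate_succ_apply']
    rw [map_average, birkhoffAverage_apply_sub_birkhoffAverage, id, id]
  have tendsto_inv : Filter.Tendsto (fun n : ℕ => ((n + 1 : ℕ) : ℝ)⁻¹)
      (Filter.hyperfilter ℕ) (𝓝 0) :=
    ((tendsto_inv_atTop_nhds_zero_nat (𝕜 := ℝ)).comp (Filter.tendsto_add_atTop_nat 1)).mono_left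
      Nat.hyperfilter_le_atTop
  obtain ⟨z, hzS, hz⟩ := hS.ultrafilter_le_nhds' ((Filter.hyperfilter ℕ).map average)
    (Filter.Eventually.of_forall average_mem : ∀ᶠ n in Filter.hyperfilter ℕ, average n ∈ S)
  have hz : Filter.Tendsto average (Filter.hyperfilter ℕ) (𝓝 z) := hz
  have bounded : Bornology.IsVonNBounded ℝ ((fun w : E × E => w.1 - w.2) '' S ×ˢ S) :=
    ((hS.prod hS).image (by fun_prop)).isVonNBounded ℝ
  have tendsto_zero : Filter.Tendsto (fun n => T (average n) - average n)
      (Filter.hyperfilter ℕ) (𝓝 0) := by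
    simp only [map_average_sub]
    exact bounded.smul_tendsto_zero (Filter.Eventually.of_forall fun n =>
      ⟨(T^[n + 1] x, x), ⟨hT.iterate _ hx, hx⟩, rfl⟩) tendsto_inv
  exact ⟨z, hzS, sub_eq_zero.1
    (tendsto_nhds_unique (((T.continuous.tendsto z).comp hz).sub hz) tendsto_zero)⟩

theorem exists_common_fixedPoint_of_commute {ι : Type*} (T : ι → E →L[ℝ] E) (hS : IsCompact S)
    (hconv : Convex ℝ S) (hne : S.Nonempty) (hT : ∀ i, Set.MapsTo (T i) S S)
    (hcomm : ∀ i j, ∀ x ∈ S, T i (T j x) = T j (T i x)) : ∃ x ∈ S, ∀ i, T i x = x := by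
  classical
  have isClosed_fixed : ∀ i, IsClosed {x | T i x = x} := fun i =>
    isClosed_eq (T i).continuous continuous_id
  have finite_case : ∀ F : Finset ι, (S ∩ ⋂ i ∈ F, {x | T i x = x}).Nonempty := fun F => by
    induction F using Finset.induction_on with
    | empty => simpa using hne
    | insert j F _ ih =>
      obtain ⟨x, hx, hjx⟩ := exists_fixedPoint_of_isCompact_of_convex (T j)
        (hS.inter_right (isClosed_biInter fun i _ => isClosed_fixed i))
        (hconv.inter (convex_iInter₂ fun i _ => (LinearMap.eqLocus (T i).toLinearMap .id).convex))
        ih fun x ⟨hxS, hxF⟩ => ⟨hT j hxS, Set.mem_iInter₂.2 fun i hi => by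
          have hix : T i x = x := Set.mem_iInter₂.1 hxF i hi
          change T i (T j x) = T j x
          rw [hcomm i j x hxS, hix]⟩
      rw [Finset.set_biInter_insert]
      exact ⟨x, hx.1, hjx, hx.2⟩
  obtain ⟨x, hxS, hx⟩ := hS.inter_iInter_nonempty (fun i => {x | T i x = x}) isClosed_fixed
    finite_case
  exact ⟨x, hxS, fun i => Set.mem_iInter.1 hx i⟩

/- By induction along the derived series: the fixed points of each of its terms form a compact
convex set, on which the preceding term acts through commuting maps. -/
theorem exists_common_fixedPoint_of_isSolvable {G : Type*} [Group G] [Group.IsSolvable G]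
    (ρ : G →* (E →L[ℝ] E)) (hS : IsCompact S) (hconv : Convex ℝ S) (hne : S.Nonempty)
    (hρ : ∀ g, Set.MapsTo (ρ g) S S) : ∃ x ∈ S, ∀ g, ρ g x = x := by
  have map_mul_apply : ∀ g h x, ρ (g * h) x = ρ g (ρ h x) := fun g h x => by rw [map_mul]; rfl
  obtain ⟨n, hn⟩ := (Group.isSolvable_def G).1 inferInstance
  suffices fixed : ∀ i ≤ n, (S ∩ ⋂ g ∈ derivedSeries G i, {x | ρ g x = x}).Nonempty by
    obtain ⟨x, hxS, hx⟩ := fixed 0 n.zero_le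
    exact ⟨x, hxS, fun g => Set.mem_iInter₂.1 hx g (Subgroup.mem_top g)⟩
  intro i hi
  induction hi using Nat.decreasingInduction with
  | self => simpa [hn] using hne
  | of_succ i _ ih =>
    obtain ⟨x, ⟨hxS, -⟩, hx⟩ := exists_common_fixedPoint_of_commute
      (fun g : derivedSeries G i => ρ (g : G))
      (hS.inter_right (isClosed_biInter fun g _ => isClosed_eq (ρ g).continuous continuous_id))
      (hconv.inter (convex_iInter₂ fun g _ => (LinearMap.eqLocus (ρ g).toLinearMap .id).convex)) ih
      (fun g x ⟨hxS, hx⟩ => ⟨hρ g hxS, Set.mem_iInter₂.2 fun k hk => by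
        have conj_mem : (g : G)⁻¹ * k * g ∈ derivedSeries G (i + 1) := by
          simpa using (derivedSeries_normal G (i + 1)).conj_mem k hk (g : G)⁻¹
        change ρ k (ρ g x) = ρ g x
        conv_rhs => rw [← show ρ _ x = x from Set.mem_iInter₂.1 hx _ conj_mem]
        rw [← map_mul_apply, ← map_mul_apply, mul_assoc, mul_inv_cancel_left]⟩)
      (fun g k x ⟨_, hx⟩ => by
        have comm_mem : (g : G)⁻¹ * (k : G)⁻¹ * g * k ∈ derivedSeries G (i + 1) := by
          simpa [commutatorElement_def] using
            Subgroup.commutator_mem_commutator (inv_mem g.2) (inv_mem k.2)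
        conv_rhs => rw [← show ρ _ x = x from Set.mem_iInter₂.1 hx _ comm_mem]
        rw [← map_mul_apply, ← map_mul_apply, ← map_mul_apply]
        congr 2
        group)
    exact ⟨x, hxS, Set.mem_iInter₂.2 fun g hg => hx ⟨g, hg⟩⟩

end CommonFixedPoint

section InvariantMean

variable (Y : Type*) [TopologicalSpace Y] [CompactSpace Y]

/-- The means on the continuous functions on a compact space: the functionals of norm at most `1`
with value `1` at the constant function `1`. They are elements of the weak-* dual because only there
they form a compact set. -/
def means : Set (WeakDual ℝ C(Y, ℝ)) :=
  WeakDual.toStrongDual ⁻¹' Metric.closedBall 0 1 ∩ {μ | μ 1 = 1}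

theorem isCompact_means : IsCompact (means Y) :=
  (WeakDual.isCompact_closedBall (0 : StrongDual ℝ C(Y, ℝ)) 1).inter_right
    (isClosed_eq (WeakDual.eval_continuous _) continuous_const)

theorem convex_means : Convex ℝ (means Y) := by
  refine ((convex_closedBall (0 : StrongDual ℝ C(Y, ℝ)) 1).linear_preimage
    (WeakDual.toStrongDual (𝕜 := ℝ) (E := C(Y, ℝ))).toLinearMap).inter ?_
  intro μ hμ ν hν a b _ _ hab
  change a • μ 1 + b • ν 1 = 1
  rw [show μ 1 = 1 from hμ, show ν 1 = 1 from hν, smul_eq_mul, smul_eq_mul, mul_one, mul_one, hab]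

variable {Y}

theorem norm_le_one_of_mem_means {μ : WeakDual ℝ C(Y, ℝ)} (hμ : μ ∈ means Y) :
    ‖WeakDual.toStrongDual μ‖ ≤ 1 :=
  (mem_closedBall_zero_iff (E := StrongDual ℝ C(Y, ℝ))).1 hμ.1

theorem mem_means {μ : WeakDual ℝ C(Y, ℝ)} (hnorm : ∀ f, ‖μ f‖ ≤ ‖f‖) (hone : μ 1 = 1) :
    μ ∈ means Y := by
  refine ⟨(mem_closedBall_zero_iff (E := StrongDual ℝ C(Y, ℝ))).2 ?_, hone⟩
  exact ContinuousLinearMap.opNorm_le_bound _ zero_le_one fun f => by rw [one_mul]; exact hnorm f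

theorem abs_apply_le_of_mem_means [Nonempty Y] {μ : WeakDual ℝ C(Y, ℝ)} (hμ : μ ∈ means Y)
    {f : C(Y, ℝ)} {δ : ℝ} (hf : ∀ y, |f y| ≤ δ) : |μ f| ≤ δ := by
  have norm_le : ‖f‖ ≤ δ := (ContinuousMap.norm_le_of_nonempty f).2 hf
  have := (WeakDual.toStrongDual μ).le_of_opNorm_le (norm_le_one_of_mem_means hμ) f
  rw [one_mul] at this
  exact this.trans norm_le

theorem means_nonempty [Nonempty Y] : (means Y).Nonempty := by
  obtain ⟨y⟩ := ‹Nonempty Y›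
  exact ⟨StrongDual.toWeakDual (ContinuousMap.evalCLM ℝ y),
    mem_means (fun f => f.norm_coe_le_norm y) rfl⟩

variable (G : Type*) [Group G] [MulAction G Y] [ContinuousConstSMul G Y]

/-- The translation of functions on `Y` by an element of a group acting on `Y`. -/
def translateFun {G : Type*} [Group G] [MulAction G Y] [ContinuousConstSMul G Y] (g : G) :
    C(Y, ℝ) →L[ℝ] C(Y, ℝ) where
  toFun f := f.comp ⟨fun y => g • y, continuous_const_smul g⟩
  map_add' _ _ := rfl
  map_smul' _ _ := rfl
  cont := ContinuousMap.continuous_precomp _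

variable (Y) in
/-- The action of a group on the weak-* dual of the functions on `Y` by translation of functions. -/
noncomputable def dualTranslation : G →* (WeakDual ℝ C(Y, ℝ) →L[ℝ] WeakDual ℝ C(Y, ℝ)) where
  toFun g :=
    { toFun := fun μ => StrongDual.toWeakDual ((WeakDual.toStrongDual μ).comp (translateFun g))
      map_add' := fun _ _ => rfl
      map_smul' := fun _ _ => rfl
      cont := WeakDual.continuous_of_continuous_eval fun _ => WeakDual.eval_continuous _ }
  map_one' := ContinuousLinearMap.ext fun μ => ContinuousLinearMap.ext fun f =>
    congrArg μ (ContinuousMap.ext fun y => congrArg f (one_smul G y))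
  map_mul' g h := ContinuousLinearMap.ext fun μ => ContinuousLinearMap.ext fun f =>
    congrArg μ (ContinuousMap.ext fun y => congrArg f (mul_smul g h y))

variable (Y) in
theorem exists_mem_means_translateFun_eq [Group.IsSolvable G] [Nonempty Y] :
    ∃ μ ∈ means Y, ∀ (g : G) (f : C(Y, ℝ)), μ (translateFun g f) = μ f := by
  have mapsTo_means : ∀ g, Set.MapsTo (dualTranslation Y G g) (means Y) (means Y) := fun g μ hμ =>
    mem_means (fun f => abs_apply_le_of_mem_means (f := translateFun g f) hμ
      fun y => f.norm_coe_le_norm (g • y)) hμ.2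
  obtain ⟨μ, hμ, hinv⟩ := exists_common_fixedPoint_of_isSolvable (dualTranslation Y G)
    (isCompact_means Y) (convex_means Y) means_nonempty mapsTo_means
  exact ⟨μ, hμ, fun g f => congrArg (fun ν : WeakDual ℝ C(Y, ℝ) => ν f) (hinv g)⟩

end InvariantMean

/-! ### Groups without homomorphisms to `ℝ` -/

theorem exists_addMonoidHom_real_ne_zero_of_infinite (A : Type*) [AddCommGroup A] [AddGroup.FG A]
    [Infinite A] : ∃ (f : A →+ ℝ) (a : A), f a ≠ 0 := by
  classical
  obtain ⟨n, ι, _, p, hp, e, ⟨f⟩⟩ := AddCommGroup.equiv_free_prod_directSum_zmod A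
  rcases Nat.eq_zero_or_pos n with rfl | hn
  · have : ∀ i, NeZero (p i ^ e i) := fun i => ⟨pow_ne_zero _ (hp i).ne_zero⟩
    have : Finite (DirectSum ι fun i => ZMod (p i ^ e i)) :=
      Finite.of_equiv _ (DirectSum.addEquivProd fun i => ZMod (p i ^ e i)).symm.toEquiv
    exact (not_finite_iff_infinite.2 ‹_› (Finite.of_equiv _ f.symm.toEquiv)).elim
  · let coordinate : (Fin n →₀ ℤ) →+ ℝ :=
      (Int.castAddHom ℝ).comp (Finsupp.applyAddHom ⟨0, hn⟩)
    exact ⟨coordinate.comp ((AddMonoidHom.fst _ _).comp f.toAddMonoidHom),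
      f.symm (Finsupp.single ⟨0, hn⟩ 1, 0), by simp [coordinate]⟩

/- The transfer to the center is the power map on the center, so a homomorphism from the center to
`ℝ` extends to the group up to a factor. -/
theorem finite_center_of_forall_hom_real_eq_one (Q : Type*) [Group Q] [Group.FG Q]
    [(Subgroup.center Q).FiniteIndex] (hQ : ∀ f : Q →* Multiplicative ℝ, f = 1) :
    Finite (Subgroup.center Q) := by
  by_contra hinf
  let _ : CommGroup (Subgroup.center Q) :=
    { (inferInstance : Group (Subgroup.center Q)) with mul_comm := mul_comm' }
  have : Infinite (Additive (Subgroup.center Q)) := not_finite_iff_infinite.1 hinf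
  obtain ⟨f, a, hfa⟩ :=
    exists_addMonoidHom_real_ne_zero_of_infinite (Additive (Subgroup.center Q))
  have transfer_eq : MonoidHom.transferCenterPow Q (a.toMul : Q) =
      a.toMul ^ (Subgroup.center Q).index := Subtype.ext (by simp)
  have apply_transfer := DFunLike.congr_fun (hQ ((AddMonoidHom.toMultiplicativeRight f).comp
    (MonoidHom.transferCenterPow Q))) (a.toMul : Q)
  rw [MonoidHom.comp_apply, transfer_eq] at apply_transfer
  have apply_pow : f ((Subgroup.center Q).index • a) = 0 := apply_transfer
  rw [map_nsmul, smul_eq_zero] at apply_pow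
  exact apply_pow.elim Subgroup.FiniteIndex.index_ne_zero hfa

theorem finite_of_isNilpotent_of_forall_hom_real_eq_one (Q : Type*) [Group Q]
    [Group.IsNilpotent Q] [Group.FG Q] (hQ : ∀ f : Q →* Multiplicative ℝ, f = 1) : Finite Q := by
  suffices H : Group.FG Q → (∀ f : Q →* Multiplicative ℝ, f = 1) → Finite Q from H ‹_› hQ
  clear hQ
  refine Group.nilpotent_center_quotient_ind
    (P := fun Q _ _ => Group.FG Q → (∀ f : Q →* Multiplicative ℝ, f = 1) → Finite Q) Q ?_ ?_
  · intro Q _ _ _ _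
    infer_instance
  · intro Q _ _ ih _ hQ
    have : Finite (Q ⧸ Subgroup.center Q) := ih inferInstance fun f =>
      QuotientGroup.monoidHom_ext _ (hQ (f.comp (QuotientGroup.mk' _)))
    have : (Subgroup.center Q).FiniteIndex := Subgroup.finiteIndex_of_finite_quotient
    have : Finite (Subgroup.center Q) := finite_center_of_forall_hom_real_eq_one Q hQ
    exact Finite.of_equiv _
      (Subgroup.groupEquivQuotientProdSubgroup (s := Subgroup.center Q)).symm

theorem hom_real_eq_one_of_bounded {G : Type*} [Group G] (X : G →* Multiplicative ℝ) {C : ℝ}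
    (hX : ∀ g, |(X g).toAdd| ≤ C) : X = 1 := by
  ext g
  by_contra hg
  have hg : (X g).toAdd ≠ 0 := hg
  obtain ⟨n, hn⟩ := exists_nat_gt (C / |(X g).toAdd|)
  have hpow := hX (g ^ n)
  rw [map_pow, toAdd_pow, nsmul_eq_mul, abs_mul, Nat.abs_cast] at hpow
  rw [div_lt_iff₀ (abs_pos.2 hg)] at hn
  exact hn.not_ge hpow

/-! ### Cocompact subgroups and equivariant functions -/

theorem exists_isCompact_forall_eq_mul {G : Type*} [Group G] [TopologicalSpace G]
    [IsTopologicalGroup G] [LocallyCompactSpace G] (Γ : Subgroup G) [CompactSpace (G ⧸ Γ)] :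
    ∃ K : Set G, IsCompact K ∧ ∀ g : G, ∃ k ∈ K, ∃ γ : Γ, g = k * γ := by
  choose L hLc hL using fun g : G => exists_compact_mem_nhds g
  obtain ⟨t, ht⟩ := (isCompact_univ (X := G ⧸ Γ)).elim_finite_subcover
    (fun g : G => ((↑) : G → G ⧸ Γ) '' interior (L g))
    (fun g => QuotientGroup.isOpenMap_coe _ isOpen_interior)
    (fun y _ => by
      obtain ⟨g, rfl⟩ := QuotientGroup.mk_surjective y
      exact Set.mem_iUnion.2 ⟨g, g, mem_interior_iff_mem_nhds.2 (hL g), rfl⟩)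
  refine ⟨⋃ g ∈ t, L g, t.isCompact_biUnion fun g _ => hLc g, fun g => ?_⟩
  obtain ⟨i, hi, k, hk, hkg⟩ := Set.mem_iUnion₂.1 (ht (Set.mem_univ (g : G ⧸ Γ)))
  exact ⟨k, Set.mem_biUnion hi (interior_subset hk), ⟨k⁻¹ * g, QuotientGroup.eq.1 hkg⟩,
    (mul_inv_cancel_left k g).symm⟩

section Equivariant

variable {G : Type*} [Group G] {Γ : Subgroup G} {χ : Γ →* Multiplicative ℝ} {c : G → ℝ}

/-- `c` is equivariant for the translation action of `Γ` on `ℝ` given by the homomorphism `χ`. -/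
def IsEquivariantUnder (χ : Γ →* Multiplicative ℝ) (c : G → ℝ) : Prop :=
  ∀ (u : G) (γ : Γ), c (u * γ) = c u + (χ γ).toAdd

theorem IsEquivariantUnder.sub_mul_right (hc : IsEquivariantUnder χ c) (u v : G) (γ : Γ) :
    c (u * γ) - c (v * γ) = c u - c v := by
  rw [hc, hc, add_sub_add_right_eq_sub]

variable [TopologicalSpace G] [IsTopologicalGroup G]

/-- The increments `c (v * u) - c u` of an equivariant function, as a function of the class of `u`
in `G ⧸ Γ`. -/
def increment (hc : IsEquivariantUnder χ c) (hcont : Continuous c) (v : G) : C(G ⧸ Γ, ℝ) where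
  toFun := Quotient.lift (fun u => c (v * u) - c u) fun a b hab => by
    have hab : a⁻¹ * b ∈ Γ := QuotientGroup.leftRel_apply.1 hab
    have := hc.sub_mul_right (v * a) a ⟨_, hab⟩
    rw [mul_assoc v, mul_inv_cancel_left] at this
    exact this.symm
  continuous_toFun := Continuous.quotient_lift (by fun_prop) _

@[simp]
theorem increment_apply (hc : IsEquivariantUnder χ c) (hcont : Continuous c) (v u : G) :
    increment hc hcont v (u : G ⧸ Γ) = c (v * u) - c u :=
  rfl

theorem increment_one (hc : IsEquivariantUnder χ c) (hcont : Continuous c) :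
    increment hc hcont 1 = 0 := by
  ext y
  obtain ⟨u, rfl⟩ := QuotientGroup.mk_surjective y
  simp

theorem increment_mul (hc : IsEquivariantUnder χ c) (hcont : Continuous c) (v w : G) :
    increment hc hcont (v * w) =
      translateFun w (increment hc hcont v) + increment hc hcont w := by
  ext y
  obtain ⟨u, rfl⟩ := QuotientGroup.mk_surjective y
  change c (v * w * u) - c u = (c (v * (w * u)) - c (w * u)) + (c (w * u) - c u)
  rw [mul_assoc, sub_add_sub_cancel]

/- The value of the homomorphism at `v` is the mean over `u ∈ G ⧸ Γ` of `c (v * u) - c u`. -/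
theorem exists_hom_real_abs_sub_le [Group.IsSolvable G] [CompactSpace (G ⧸ Γ)]
    (hc : IsEquivariantUnder χ c) (hcont : Continuous c) :
    ∃ X : G →* Multiplicative ℝ, ∀ (v w : G) (a δ : ℝ),
      (∀ u, |c (v * u) - c (w * u) - a| ≤ δ) → |(X v).toAdd - (X w).toAdd - a| ≤ δ := by
  obtain ⟨μ, hμ, μ_translate⟩ := exists_mem_means_translateFun_eq (G ⧸ Γ) G
  let X : G →* Multiplicative ℝ :=
    { toFun := fun v => .ofAdd (μ (increment hc hcont v))
      map_one' := by rw [increment_one, map_zero, ofAdd_zero]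
      map_mul' := fun v w => by rw [increment_mul, map_add, μ_translate, ofAdd_add] }
  refine ⟨X, fun v w a δ h => ?_⟩
  have mean_eq : (X v).toAdd - (X w).toAdd - a =
      μ (increment hc hcont v - increment hc hcont w - a • 1) := by
    rw [map_sub, map_sub, map_smul, show μ 1 = 1 from hμ.2, smul_eq_mul, mul_one]
    rfl
  rw [mean_eq]
  refine abs_apply_le_of_mem_means hμ fun y => ?_
  obtain ⟨u, rfl⟩ := QuotientGroup.mk_surjective y
  simpa using h u

theorem exists_abs_sub_le_of_isCompact [LocallyCompactSpace G] [CompactSpace (G ⧸ Γ)]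
    (hc : IsEquivariantUnder χ c) (hcont : Continuous c) {K : Set G} (hK : IsCompact K) :
    ∃ C, ∀ k ∈ K, ∀ u, |c (k * u) - c u| ≤ C := by
  obtain ⟨L, hL, hLΓ⟩ := exists_isCompact_forall_eq_mul Γ
  obtain ⟨C, hC⟩ := (hK.prod hL).exists_bound_of_continuousOn
    (f := fun z : G × G => c (z.1 * z.2) - c z.2) (by fun_prop)
  refine ⟨C, fun k hk u => ?_⟩
  obtain ⟨l, hl, γ, rfl⟩ := hLΓ u
  rw [← mul_assoc, hc.sub_mul_right]
  exact hC (k, l) ⟨hk, hl⟩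

/- If `v` is central modulo the `i`-th term of the upper central series, then `v * k` is `k * v` up
to an element of this term, so that moving the base point of an increment by `k ∈ K` reduces the
claim for `v` to the claim for a commutator, where `X` vanishes. -/
theorem exists_abs_increment_sub_le_of_mem_upperCentralSeries [LocallyCompactSpace G]
    [CompactSpace (G ⧸ Γ)] (hc : IsEquivariantUnder χ c) (hcont : Continuous c)
    {X : G →* Multiplicative ℝ}
    (hX : ∀ (v w : G) (a δ : ℝ),
      (∀ u, |c (v * u) - c (w * u) - a| ≤ δ) → |(X v).toAdd - (X w).toAdd - a| ≤ δ) (i : ℕ) :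
    ∃ C, ∀ v ∈ Subgroup.upperCentralSeries G i, ∀ u, |c (v * u) - c u - (X v).toAdd| ≤ C := by
  obtain ⟨K, hK, hKΓ⟩ := exists_isCompact_forall_eq_mul Γ
  obtain ⟨C, hC⟩ := exists_abs_sub_le_of_isCompact hc hcont hK
  induction i with
  | zero =>
    refine ⟨0, fun v hv u => ?_⟩
    simp [show v = 1 by simpa using hv]
  | succ i ih =>
    obtain ⟨D, hD⟩ := ih
    refine ⟨2 * (D + 2 * C), fun v hv u => ?_⟩
    have oscillation : ∀ u, |c (v * u) - c u - (c v - c 1)| ≤ D + 2 * C := fun u => by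
      obtain ⟨k, hk, γ, rfl⟩ := hKΓ u
      rw [← mul_assoc, hc.sub_mul_right]
      have X_commutator : (X (v * k * v⁻¹ * k⁻¹)).toAdd = 0 := by
        simp only [map_mul, map_inv, toAdd_mul, toAdd_inv]
        ring
      have hcomm : v * k * v⁻¹ * k⁻¹ ∈ Subgroup.upperCentralSeries G i :=
        Subgroup.mem_upperCentralSeries_succ_iff.1 hv k
      have h₁ := hD _ hcomm (k * v)
      rw [X_commutator, sub_zero, show v * k * v⁻¹ * k⁻¹ * (k * v) = v * k by group] at h₁
      have h₂ := hC k hk v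
      have h₃ := hC k hk 1
      rw [mul_one] at h₃
      rw [abs_le] at *
      constructor <;> linarith [h₁.1, h₁.2, h₂.1, h₂.2, h₃.1, h₃.2]
    have mean : |(X v).toAdd - (c v - c 1)| ≤ D + 2 * C := by
      simpa using hX v 1 (c v - c 1) (D + 2 * C) (by simpa using oscillation)
    have := oscillation u
    rw [abs_le] at *
    constructor <;> linarith [this.1, this.2, mean.1, mean.2]

theorem exists_hom_real_abs_increment_sub_le [LocallyCompactSpace G] [Group.IsNilpotent G]
    [CompactSpace (G ⧸ Γ)] (hc : IsEquivariantUnder χ c) (hcont : Continuous c) :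
    ∃ X : G →* Multiplicative ℝ,
      (∃ C, ∀ v u, |c (v * u) - c u - (X v).toAdd| ≤ C) ∧
      ∀ v w δ, (∀ u, |c (v * u) - c (w * u)| ≤ δ) → |(X v).toAdd - (X w).toAdd| ≤ δ := by
  obtain ⟨X, hX⟩ := exists_hom_real_abs_sub_le hc hcont
  obtain ⟨n, hn⟩ := (Group.isNilpotent_iff G).1 ‹_›
  obtain ⟨C, hC⟩ := exists_abs_increment_sub_le_of_mem_upperCentralSeries hc hcont hX n
  refine ⟨X, ⟨C, fun v => hC v (hn ▸ Subgroup.mem_top v)⟩, fun v w δ h => ?_⟩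
  simpa using hX v w 0 δ (by simpa using h)

end Equivariant

/-! ### Discrete cocompact subgroups -/

section CocompactSubgroup

open scoped Pointwise

variable {G : Type*} [Group G] [TopologicalSpace G] [IsTopologicalGroup G]

theorem closure_setOf_coe_mem_inv_mul_eq_top [ConnectedSpace G] (Γ : Subgroup G) {U : Set G}
    (hU : IsOpen U) (hUΓ : ∀ g : G, ∃ u ∈ U, ∃ γ : Γ, g = u * γ) :
    Subgroup.closure {γ : Γ | (γ : G) ∈ U⁻¹ * U} = ⊤ := by
  set Λ := Subgroup.closure {γ : Γ | (γ : G) ∈ U⁻¹ * U}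
  have mem_of_mul_eq {u v : G} (hu : u ∈ U) (hv : v ∈ U) {γ η : Γ} (hη : η ∈ Λ)
      (h : u * γ = v * η) : γ ∈ Λ := by
    have hquot : γ * η⁻¹ ∈ Λ := Subgroup.subset_closure
      ⟨u⁻¹, Set.inv_mem_inv.2 hu, v, hv, by
        simp only [Subgroup.coe_mul, Subgroup.coe_inv]
        rw [inv_mul_eq_iff_eq_mul, ← mul_assoc, h, mul_inv_cancel_right]⟩
    simpa using mul_mem hquot hη
  let A : Set Γ → Set G := fun S => U * ((↑) '' S)
  have hcover : Set.univ ⊆ A Λ ∪ A (Λ : Set Γ)ᶜ := fun g _ => by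
    obtain ⟨u, hu, γ, rfl⟩ := hUΓ g
    exact (em (γ ∈ Λ)).imp (fun h => Set.mul_mem_mul hu ⟨γ, h, rfl⟩)
      fun h => Set.mul_mem_mul hu ⟨γ, h, rfl⟩
  have hdisj : Disjoint (A Λ) (A (Λ : Set Γ)ᶜ) := by
    rw [Set.disjoint_left]
    rintro _ ⟨v, hv, _, ⟨η, hη, rfl⟩, rfl⟩ ⟨u, hu, _, ⟨γ, hγ, rfl⟩, h⟩
    exact hγ (mem_of_mul_eq hu hv hη h)
  obtain ⟨u₀, hu₀, -⟩ := hUΓ 1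
  have huniv : Set.univ ⊆ A Λ :=
    isPreconnected_univ.subset_left_of_subset_union hU.mul_right hU.mul_right hdisj hcover
      ⟨u₀, trivial, u₀, hu₀, 1, ⟨1, one_mem Λ, rfl⟩, mul_one u₀⟩
  refine eq_top_iff.2 fun γ _ => ?_
  obtain ⟨v, hv, _, ⟨η, hη, rfl⟩, h⟩ := huniv (Set.mem_univ (u₀ * γ))
  exact mem_of_mul_eq hu₀ hv hη h.symm

variable [T2Space G] (Γ : Subgroup G) [DiscreteTopology Γ]

theorem finite_setOf_coe_mem_of_isCompact {K : Set G} (hK : IsCompact K) :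
    {γ : Γ | (γ : G) ∈ K}.Finite := by
  have hcof := Γ.tendsto_coe_cofinite_of_discrete (isDiscrete_iff_discreteTopology.2 inferInstance)
    hK.compl_mem_cocompact
  rw [Filter.mem_map, Filter.mem_cofinite, Set.preimage_compl, compl_compl] at hcof
  exact hcof

theorem group_fg_of_discrete_of_cocompact [LocallyCompactSpace G] [ConnectedSpace G]
    [CompactSpace (G ⧸ Γ)] : Group.FG Γ := by
  obtain ⟨K, hK, hKΓ⟩ := exists_isCompact_forall_eq_mul Γ
  obtain ⟨L, hL, hKL⟩ := exists_compact_superset hK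
  refine Group.fg_iff.2 ⟨_, closure_setOf_coe_mem_inv_mul_eq_top Γ isOpen_interior fun g => ?_,
    (finite_setOf_coe_mem_of_isCompact Γ (hL.inv.mul hL)).subset fun γ hγ =>
      Set.mul_subset_mul (Set.inv_subset_inv.2 interior_subset) interior_subset hγ⟩
  obtain ⟨k, hk, γ, hg⟩ := hKΓ g
  exact ⟨k, hKL hk, γ, hg⟩

end CocompactSubgroup

theorem exists_contMDiff_hasCompactSupport_pos {E H M : Type*} [NormedAddCommGroup E]
    [NormedSpace ℝ E] [FiniteDimensional ℝ E] [TopologicalSpace H] (I : ModelWithCorners ℝ E H)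
    [TopologicalSpace M] [ChartedSpace H M] [IsManifold I ∞ M] [T2Space M] {K : Set M}
    (hK : IsCompact K) :
    ∃ θ : M → ℝ, ContMDiff I 𝓘(ℝ, ℝ) ∞ θ ∧ HasCompactSupport θ ∧ (∀ u, 0 ≤ θ u) ∧
      ∀ u ∈ K, 0 < θ u := by
  let b : ∀ x : M, SmoothBumpFunction I x := fun _ => Classical.arbitrary _
  obtain ⟨t, -, ht⟩ := hK.elim_nhds_subcover (fun x => {u | 0 < b x u}) fun x _ => by
    filter_upwards [(b x).eventuallyEq_one] with u hu
    exact hu.symm ▸ zero_lt_one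
  refine ⟨fun u => ∑ x ∈ t, b x u, contMDiff_finsetSum fun x _ => (b x).contMDiff, ?_,
    fun u => Finset.sum_nonneg fun x _ => (b x).nonneg, fun u hu => ?_⟩
  · refine HasCompactSupport.intro
      (t.isCompact_biUnion fun x _ => (b x).hasCompactSupport) fun u hu => ?_
    exact Finset.sum_eq_zero fun x hx =>
      image_eq_zero_of_notMem_tsupport fun h => hu (Set.mem_biUnion hx h)
  · obtain ⟨x, hx, hxu⟩ := Set.mem_iUnion₂.1 (ht hu)
    exact Finset.sum_pos' (fun x _ => (b x).nonneg) ⟨x, hx, hxu⟩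

section WeightedOrbitSum

variable {G : Type*} [Group G] (Γ : Subgroup G)

/-- The sum of `θ` over the orbit of `u` under right translation by `Γ`, the value at `u * γ` being
weighted by `a γ`. -/
noncomputable def weightedOrbitSum (θ : G → ℝ) (a : Γ → ℝ) (u : G) : ℝ :=
  ∑ᶠ γ : Γ, a γ * θ (u * γ)

theorem weightedOrbitSum_mul_right (θ : G → ℝ) (a : Γ → ℝ) (u : G) (η : Γ) :
    weightedOrbitSum Γ θ a (u * η) = weightedOrbitSum Γ θ (fun γ => a (η⁻¹ * γ)) u := by
  unfold weightedOrbitSum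
  rw [← finsum_comp_equiv (Equiv.mulLeft η) (f := fun γ : Γ => a (η⁻¹ * γ) * θ (u * γ))]
  simp [mul_assoc]

variable [TopologicalSpace G] [T2Space G] [LocallyCompactSpace G] [DiscreteTopology Γ]
  {θ : G → ℝ} (hθ : HasCompactSupport θ)
include hθ

theorem exists_mem_nhds_finite_setOf_ne_zero [IsTopologicalGroup G] (u : G) :
    ∃ V ∈ 𝓝 u, {γ : Γ | ∃ v ∈ V, θ (v * γ) ≠ 0}.Finite := by
  obtain ⟨V, hVc, hV⟩ := exists_compact_mem_nhds u
  refine ⟨V, hV, (finite_setOf_coe_mem_of_isCompact Γ (hVc.inv.mul hθ)).subset ?_⟩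
  rintro γ ⟨v, hv, hvγ⟩
  exact ⟨v⁻¹, Set.inv_mem_inv.2 hv, v * γ, subset_tsupport _ hvγ, by simp⟩

theorem finite_support_mul_translate [IsTopologicalGroup G] (a : Γ → ℝ) (u : G) :
    (Function.support fun γ : Γ => a γ * θ (u * γ)).Finite := by
  obtain ⟨V, hV, hfin⟩ := exists_mem_nhds_finite_setOf_ne_zero Γ hθ u
  exact hfin.subset fun γ hγ => ⟨u, mem_of_mem_nhds hV, right_ne_zero_of_mul hγ⟩

theorem contMDiff_weightedOrbitSum {E H : Type*} [NormedAddCommGroup E] [NormedSpace ℝ E]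
    [TopologicalSpace H] {I : ModelWithCorners ℝ E H} [ChartedSpace H G] [LieGroup I ∞ G]
    (hsmooth : ContMDiff I 𝓘(ℝ, ℝ) ∞ θ) (a : Γ → ℝ) :
    ContMDiff I 𝓘(ℝ, ℝ) ∞ (weightedOrbitSum Γ θ a) := by
  have : IsTopologicalGroup G := topologicalGroup_of_lieGroup I ∞
  refine contMDiff_finsum (fun γ => contMDiff_const.mul
    (hsmooth.comp (contMDiff_mul_right (a := (γ : G))))) fun u => ?_
  obtain ⟨V, hV, hfin⟩ := exists_mem_nhds_finite_setOf_ne_zero Γ hθ u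
  refine ⟨V, hV, hfin.subset ?_⟩
  rintro γ ⟨v, hv, hvV⟩
  exact ⟨v, hvV, right_ne_zero_of_mul hv⟩

theorem weightedOrbitSum_sub [IsTopologicalGroup G] (a b : Γ → ℝ) (u : G) :
    weightedOrbitSum Γ θ (fun γ => a γ - b γ) u =
      weightedOrbitSum Γ θ a u - weightedOrbitSum Γ θ b u := by
  simp only [weightedOrbitSum, sub_mul]
  exact finsum_sub_distrib (finite_support_mul_translate Γ hθ a u)
    (finite_support_mul_translate Γ hθ b u)

end WeightedOrbitSum

theorem exists_contMDiff_isEquivariantUnder {E H G : Type*} [NormedAddCommGroup E]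
    [NormedSpace ℝ E] [FiniteDimensional ℝ E] [TopologicalSpace H] (I : ModelWithCorners ℝ E H)
    [Group G] [TopologicalSpace G] [ChartedSpace H G] [LieGroup I ∞ G] [T2Space G]
    [LocallyCompactSpace G] (Γ : Subgroup G) [DiscreteTopology Γ] [CompactSpace (G ⧸ Γ)]
    (χ : Γ →* Multiplicative ℝ) :
    ∃ c : G → ℝ, ContMDiff I 𝓘(ℝ, ℝ) ∞ c ∧ IsEquivariantUnder χ c := by
  have : IsTopologicalGroup G := topologicalGroup_of_lieGroup I ∞
  obtain ⟨K, hK, hKΓ⟩ := exists_isCompact_forall_eq_mul Γ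
  obtain ⟨θ, hsmooth, hsupp, hθ, hθK⟩ := exists_contMDiff_hasCompactSupport_pos I hK
  let s : G → ℝ := weightedOrbitSum Γ θ fun _ => 1
  let d : G → ℝ := weightedOrbitSum Γ θ fun γ => (χ γ).toAdd
  have hs_pos u : 0 < s u := by
    obtain ⟨k, hk, γ, rfl⟩ := hKΓ u
    exact finsum_pos (fun η => by simpa using hθ _) ⟨γ⁻¹, by simpa using hθK k hk⟩
      (finite_support_mul_translate Γ hsupp _ _)
  have hs u (γ : Γ) : s (u * γ) = s u := weightedOrbitSum_mul_right Γ θ _ u γ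
  have hd u (γ : Γ) : d (u * γ) = d u - (χ γ).toAdd * s u := by
    have hconst : weightedOrbitSum Γ θ (fun _ => (χ γ).toAdd) u = (χ γ).toAdd * s u := by
      simp only [s, weightedOrbitSum, one_mul, mul_finsum]
    rw [← hconst, ← weightedOrbitSum_sub Γ hsupp]
    refine (weightedOrbitSum_mul_right Γ θ _ u γ).trans ?_
    simp only [map_mul, map_inv, toAdd_mul, toAdd_inv, neg_add_eq_sub]
  have hsum := contMDiff_weightedOrbitSum Γ hsupp hsmooth
  refine ⟨fun u => -(d u / s u), ((hsum _).div₀ (hsum _) fun u => (hs_pos u).ne').neg,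
    fun u γ => ?_⟩
  have := (hs_pos u).ne'
  simp only [hs, hd]
  field_simp
  ring

/-! ### Differentiability of homomorphisms to the real line -/

section Differentiability

variable {E H : Type*} [NormedAddCommGroup E] [NormedSpace ℝ E] [TopologicalSpace H]
  {I : ModelWithCorners ℝ E H} [I.Boundaryless]

theorem exists_mdifferentiableAt_of_lipschitzOnWith [FiniteDimensional ℝ E] {M F : Type*}
    [TopologicalSpace M] [ChartedSpace H M] [IsManifold I 1 M] [NormedAddCommGroup F]
    [NormedSpace ℝ F] [FiniteDimensional ℝ F] {f : M → F} {x : M} {U : Set E}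
    (hU : U ∈ 𝓝 (extChartAt I x x)) {C : NNReal}
    (hf : LipschitzOnWith C (f ∘ (extChartAt I x).symm) U) :
    ∃ y, MDifferentiableAt I 𝓘(ℝ, F) f y := by
  borelize E
  set φ := extChartAt I x
  obtain ⟨O, hO_sub, hO, hxO⟩ :=
    mem_nhds_iff.1 (Filter.inter_mem hU (extChartAt_target_mem_nhds x))
  have hf_ae := (hf.mono fun ξ hξ => (hO_sub hξ).1).ae_differentiableWithinAt
    (μ := MeasureTheory.Measure.addHaar) hO.measurableSet
  have : (MeasureTheory.ae (MeasureTheory.Measure.addHaar.restrict O)).NeBot := by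
    rw [MeasureTheory.ae_neBot, Ne, MeasureTheory.Measure.restrict_eq_zero]
    exact (hO.measure_pos _ ⟨_, hxO⟩).ne'
  obtain ⟨ξ, hξ, hξO⟩ := (hf_ae.and (MeasureTheory.ae_restrict_mem hO.measurableSet)).exists
  have hξ_target : ξ ∈ φ.target := (hO_sub hξO).2
  refine ⟨φ.symm ξ, ?_⟩
  have hφ : MDifferentiableAt I 𝓘(ℝ, E) φ (φ.symm ξ) :=
    (contMDiffAt_extChartAt' (n := 1) (by simpa [φ] using φ.map_target hξ_target)).mdifferentiableAt
      one_ne_zero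
  have hfφ : MDifferentiableAt 𝓘(ℝ, E) 𝓘(ℝ, F) (f ∘ φ.symm) (φ (φ.symm ξ)) := by
    rw [φ.right_inv hξ_target]
    exact (hξ.differentiableAt (hO.mem_nhds hξO)).mdifferentiableAt
  refine (hfφ.comp _ hφ).congr_of_eventuallyEq ?_
  filter_upwards [(isOpen_extChartAt_source (I := I) x).mem_nhds (φ.map_target hξ_target)] with u hu
  simp only [Function.comp_apply, φ.left_inv hu]

variable {G : Type*} [Group G] [TopologicalSpace G] [ChartedSpace H G]

omit [I.Boundaryless] in
theorem mdifferentiableAt_one_of_mdifferentiableAt_hom_real [ContMDiffMul I 1 G]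
    {X : G →* Multiplicative ℝ} {g : G}
    (hX : MDifferentiableAt I 𝓘(ℝ, ℝ) (fun u => (X u).toAdd) g) :
    MDifferentiableAt I 𝓘(ℝ, ℝ) (fun u => (X u).toAdd) 1 := by
  have hmul : MDifferentiableAt I I (g * ·) (1 : G) :=
    (contMDiff_mul_left (n := 1) (a := g)).mdifferentiableAt one_ne_zero
  rw [← mul_one g] at hX
  have hshift := (MDifferentiableAt.comp (1 : G) hX hmul).sub
    (mdifferentiableAt_const (I := I) (I' := 𝓘(ℝ, ℝ)) (c := (X g).toAdd))
  refine hshift.congr_of_eventuallyEq (Filter.Eventually.of_forall fun u => ?_)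
  simp

variable {c : G → ℝ}

theorem exists_lipschitzOnWith_mul_near [ContMDiffMul I 1 G] (hc : ContMDiff I 𝓘(ℝ, ℝ) 1 c)
    (k : G) :
    ∃ W ∈ 𝓝 k, ∃ U ∈ 𝓝 (extChartAt I (1 : G) 1), ∃ C : NNReal, ∀ u ∈ W,
      LipschitzOnWith C (fun ξ => c ((extChartAt I (1 : G)).symm ξ * u)) U := by
  have hsymm (g : G) : ContMDiffAt 𝓘(ℝ, E) I 1 (extChartAt I g).symm (extChartAt I g g) :=
    (contMDiffOn_extChartAt_symm g).contMDiffAt (extChartAt_target_mem_nhds g)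
  have hsmooth : ContMDiffAt 𝓘(ℝ, E × E) 𝓘(ℝ, ℝ) 1
      (fun z : E × E => c ((extChartAt I (1 : G)).symm z.1 * (extChartAt I k).symm z.2))
      (extChartAt I (1 : G) 1, extChartAt I k k) := by
    refine (hc _).comp _ (ContMDiffAt.mul ?_ ?_)
    · exact ContMDiffAt.comp _ (hsymm 1) contDiff_fst.contMDiff.contMDiffAt
    · exact ContMDiffAt.comp _ (hsymm k) contDiff_snd.contMDiff.contMDiffAt
  obtain ⟨C, t, ht, hlip⟩ := (contMDiffAt_iff_contDiffAt.1 hsmooth).exists_lipschitzOnWith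
  rw [nhds_prod_eq] at ht
  obtain ⟨U, hU, V, hV, hUV⟩ := Filter.mem_prod_iff.1 ht
  refine ⟨(extChartAt I k).source ∩ extChartAt I k ⁻¹' V, Filter.inter_mem
    (extChartAt_source_mem_nhds k) (continuousAt_extChartAt k hV), U, hU, C, ?_⟩
  rintro u ⟨hu_source, huV⟩
  refine LipschitzOnWith.of_dist_le_mul fun ξ hξ η hη => ?_
  have hdist := hlip.dist_le_mul (ξ, extChartAt I k u) (hUV ⟨hξ, huV⟩)
    (η, extChartAt I k u) (hUV ⟨hη, huV⟩)
  simpa only [Prod.dist_eq, (extChartAt I k).left_inv hu_source, dist_self,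
    max_eq_left dist_nonneg] using hdist

theorem exists_lipschitzOnWith_mul_of_isCompact [ContMDiffMul I 1 G]
    (hc : ContMDiff I 𝓘(ℝ, ℝ) 1 c) {K : Set G} (hK : IsCompact K) :
    ∃ U ∈ 𝓝 (extChartAt I (1 : G) 1), ∃ C : NNReal, ∀ u ∈ K,
      LipschitzOnWith C (fun ξ => c ((extChartAt I (1 : G)).symm ξ * u)) U := by
  refine hK.induction_on ⟨Set.univ, Filter.univ_mem, 0, by simp⟩ ?_ ?_ fun k _ => ?_
  · rintro s t hst ⟨U, hU, C, h⟩
    exact ⟨U, hU, C, fun u hu => h u (hst hu)⟩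
  · rintro s t ⟨U, hU, C, h⟩ ⟨V, hV, D, h'⟩
    refine ⟨U ∩ V, Filter.inter_mem hU hV, max C D, ?_⟩
    rintro u (hu | hu)
    · exact ((h u hu).mono Set.inter_subset_left).weaken (le_max_left _ _)
    · exact ((h' u hu).mono Set.inter_subset_right).weaken (le_max_right _ _)
  · obtain ⟨W, hW, h⟩ := exists_lipschitzOnWith_mul_near hc k
    exact ⟨W, mem_nhdsWithin_of_mem_nhds hW, h⟩

end Differentiability

section Invariance

variable {G : Type*} [Group G] {Γ : Subgroup G} {χ : Γ →* Multiplicative ℝ} {c : G → ℝ}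
  {X : G →* Multiplicative ℝ} {C : ℝ}

theorem IsEquivariantUnder.eq_one_of_abs_sub_le (hc : IsEquivariantUnder χ c)
    (hC : ∀ v u, |c (v * u) - c u| ≤ C) : χ = 1 := by
  refine hom_real_eq_one_of_bounded χ (C := C) fun γ => ?_
  have hγ := hc 1 γ
  rw [one_mul] at hγ
  simpa only [mul_one, hγ, add_sub_cancel_left] using hC γ 1

theorem IsEquivariantUnder.comp_eq_of_abs_increment_sub_le [TopologicalSpace G]
    [IsTopologicalGroup G] [LocallyCompactSpace G] [CompactSpace (G ⧸ Γ)]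
    (hc : IsEquivariantUnder χ c) (hcont : Continuous c)
    (hC : ∀ v u, |c (v * u) - c u - (X v).toAdd| ≤ C) {B : G →* G} (hBcont : Continuous B)
    (hB : ∀ γ : Γ, B γ ∈ Γ) (hχ : ∀ γ : Γ, χ ⟨B γ, hB γ⟩ = χ γ) : X.comp B = X := by
  obtain ⟨K, hK, hKΓ⟩ := exists_isCompact_forall_eq_mul Γ
  obtain ⟨D, hD⟩ : ∃ D, ∀ u, |c (B u) - c u| ≤ D := by
    obtain ⟨D, hD⟩ := hK.exists_bound_of_continuousOn
      ((hcont.comp hBcont).sub hcont).continuousOn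
    refine ⟨D, fun u => ?_⟩
    obtain ⟨k, hk, γ, rfl⟩ := hKΓ u
    have hBk : c (B k * B γ) = c (B k) + (χ γ).toAdd := hχ γ ▸ hc (B k) ⟨B γ, hB γ⟩
    rw [map_mul, hBk, hc, add_sub_add_right_eq_sub]
    exact hD k hk
  have hquot : X.comp B / X = 1 := by
    refine hom_real_eq_one_of_bounded _ (C := 2 * C + 2 * D) fun v => ?_
    have hBv := hC (B v) 1
    have hv := hC v 1
    have hDv := hD v
    have hD1 := hD 1
    rw [mul_one] at hBv hv
    rw [map_one] at hD1
    rw [MonoidHom.div_apply, toAdd_div, MonoidHom.comp_apply]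
    rw [abs_le] at *
    constructor <;> linarith [hBv.1, hBv.2, hv.1, hv.2, hDv.1, hDv.2, hD1.1, hD1.2]
  exact div_eq_one.1 hquot

end Invariance

theorem exists_hom_real_mdifferentiableAt {E H G : Type*} [NormedAddCommGroup E]
    [NormedSpace ℝ E] [FiniteDimensional ℝ E] [TopologicalSpace H] (I : ModelWithCorners ℝ E H)
    [I.Boundaryless] [Group G] [TopologicalSpace G] [ChartedSpace H G] [LieGroup I ∞ G]
    [T2Space G] [LocallyCompactSpace G] [Group.IsNilpotent G] (Γ : Subgroup G)
    [DiscreteTopology Γ] [CompactSpace (G ⧸ Γ)] (χ : Γ →* Multiplicative ℝ) :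
    ∃ X : G →* Multiplicative ℝ, MDifferentiableAt I 𝓘(ℝ, ℝ) (fun g => (X g).toAdd) 1 ∧
      (X = 1 → χ = 1) ∧ ∀ B : G →* G, Continuous B → ∀ hB : ∀ γ : Γ, B γ ∈ Γ,
        (∀ γ : Γ, χ ⟨B γ, hB γ⟩ = χ γ) → X.comp B = X := by
  have : IsTopologicalGroup G := topologicalGroup_of_lieGroup I ∞
  obtain ⟨c, hsmooth, hc⟩ := exists_contMDiff_isEquivariantUnder I Γ χ
  obtain ⟨X, ⟨C, hC⟩, hmod⟩ := exists_hom_real_abs_increment_sub_le hc hsmooth.continuous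
  refine ⟨X, ?_, ?_, fun B hBcont hB hχ =>
    hc.comp_eq_of_abs_increment_sub_le hsmooth.continuous hC hBcont hB hχ⟩
  · obtain ⟨K, hK, hKΓ⟩ := exists_isCompact_forall_eq_mul Γ
    obtain ⟨U, hU, D, hD⟩ := exists_lipschitzOnWith_mul_of_isCompact (I := I)
      (hsmooth.of_le (by simp)) hK
    have hX : LipschitzOnWith D
        ((fun g => (X g).toAdd) ∘ (extChartAt I (1 : G)).symm) U := by
      refine LipschitzOnWith.of_dist_le_mul fun ξ hξ η hη => hmod _ _ _ fun u => ?_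
      obtain ⟨k, hk, γ, rfl⟩ := hKΓ u
      rw [← mul_assoc, ← mul_assoc, hc.sub_mul_right]
      exact (hD k hk).dist_le_mul ξ hξ η hη
    obtain ⟨g, hg⟩ := exists_mdifferentiableAt_of_lipschitzOnWith hU hX
    exact mdifferentiableAt_one_of_mdifferentiableAt_hom_real hg
  · rintro rfl
    exact hc.eq_one_of_abs_sub_le (by simpa using hC)

/-! ### Invariant functionals of hyperbolic maps -/

section Hyperbolic

variable {V : Type*} [NormedAddCommGroup V] [NormedSpace ℝ V] {A : Module.End ℝ V}

theorem norm_iterate_lt_norm (hA : ∀ v, v ≠ 0 → ‖A v‖ < ‖v‖) {j : ℕ} (hj : j ≠ 0) {v : V}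
    (hv : v ≠ 0) : ‖A^[j] v‖ < ‖v‖ := by
  obtain ⟨i, rfl⟩ := Nat.exists_eq_succ_of_ne_zero hj
  have hle (w : V) : ‖A w‖ ≤ ‖w‖ := by
    obtain rfl | hw := eq_or_ne w 0
    · simp
    · exact (hA w hw).le
  induction i with
  | zero => exact hA v hv
  | succ i ih =>
    rw [Function.iterate_succ_apply']
    exact (hle _).trans_lt (ih i.succ_ne_zero)

variable [FiniteDimensional ℝ V]

/- The norm of `l` is attained at some unit vector `v`, and `l (A^[j] v) = l v` although `A^[j] v`
is shorter than `v`. -/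
theorem dual_eq_zero_of_forall_norm_map_lt (hA : ∀ v, v ≠ 0 → ‖A v‖ < ‖v‖) {j : ℕ} (hj : j ≠ 0)
    {l : Module.Dual ℝ V} (hl : ∀ v, l (A^[j] v) = l v) : l = 0 := by
  by_contra hl0
  obtain ⟨w, hw⟩ : ∃ w, l w ≠ 0 := by
    by_contra! h
    exact hl0 (LinearMap.ext h)
  obtain ⟨v, hv, hmax⟩ := (isCompact_closedBall (0 : V) 1).exists_isMaxOn
    ⟨0, Metric.mem_closedBall_self zero_le_one⟩ l.toContinuousLinearMap.continuous.continuousOn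
  have hbound (u : V) : l u ≤ l v * ‖u‖ := by
    obtain rfl | hu := eq_or_ne u 0
    · simp
    have hunit := hmax (show ‖u‖⁻¹ • u ∈ Metric.closedBall (0 : V) 1 by
      simp [norm_smul, inv_mul_cancel₀ (norm_ne_zero_iff.2 hu)])
    have hu_pos := norm_pos_iff.2 hu
    simp only [Set.mem_ofPred_eq, LinearMap.coe_toContinuousLinearMap', map_smul,
      smul_eq_mul] at hunit
    rwa [inv_mul_le_iff₀ hu_pos, mul_comm] at hunit
  have hlv : 0 < l v := by
    have hw_pos := hbound w
    have hw_neg := hbound (-w)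
    rw [map_neg, norm_neg] at hw_neg
    by_contra! hle
    have := mul_nonpos_of_nonpos_of_nonneg hle (norm_nonneg w)
    exact hw (by linarith)
  have hv0 : v ≠ 0 := by
    rintro rfl
    simp at hlv
  have hlt : l v < l v := by
    calc l v = l (A^[j] v) := (hl v).symm
      _ ≤ l v * ‖A^[j] v‖ := hbound _
      _ < l v * ‖v‖ := by gcongr; exact norm_iterate_lt_norm hA hj hv0
      _ ≤ l v * 1 := by gcongr; simpa using hv
      _ = l v := mul_one _
  exact hlt.false

theorem dual_eq_zero_of_forall_lt_norm_map (hA : ∀ v, v ≠ 0 → ‖v‖ < ‖A v‖) {j : ℕ} (hj : j ≠ 0)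
    {l : Module.Dual ℝ V} (hl : ∀ v, l (A^[j] v) = l v) : l = 0 := by
  have hinj : Function.Injective A := by
    rw [← LinearMap.ker_eq_bot, LinearMap.ker_eq_bot']
    intro v hv
    by_contra hv0
    have hlt := hA v hv0
    rw [hv, norm_zero] at hlt
    exact hlt.not_ge (norm_nonneg v)
  let e := LinearEquiv.ofInjectiveEndo A hinj
  have he : Function.RightInverse e.symm A := e.apply_symm_apply
  refine dual_eq_zero_of_forall_norm_map_lt (A := e.symm.toLinearMap) (fun v hv => ?_) hj
    fun v => ?_
  · simpa [he v] using hA (e.symm v) (by simpa using hv)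
  · rw [← hl]
    exact congrArg l (he.iterate j v)

omit [FiniteDimensional ℝ V] in
theorem exists_unit_smul {v : V} (hv : v ≠ 0) : ∃ u, ‖u‖ = 1 ∧ v = ‖v‖ • u :=
  ⟨‖v‖⁻¹ • v, norm_smul_inv_norm (𝕜 := ℝ) hv, (smul_inv_smul₀ (norm_ne_zero_iff.2 hv) v).symm⟩

theorem dual_eq_zero_of_hyperbolic {Es Eu : Submodule ℝ V} (hE : Es ⊔ Eu = ⊤)
    (hEs : ∀ v ∈ Es, A v ∈ Es) (hEu : ∀ v ∈ Eu, A v ∈ Eu)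
    (hcontr : ∀ v ∈ Es, ‖v‖ = 1 → ‖A v‖ < 1) (hexp : ∀ v ∈ Eu, ‖v‖ = 1 → 1 < ‖A v‖)
    {j : ℕ} (hj : j ≠ 0) {l : Module.Dual ℝ V} (hl : ∀ v, l (A^[j] v) = l v) : l = 0 := by
  have hrestrict {S : Submodule ℝ V} (hS : ∀ v ∈ S, A v ∈ S) (v : S) :
      l.domRestrict S ((A.restrict hS)^[j] v) = l.domRestrict S v := by
    rw [LinearMap.domRestrict_apply, LinearMap.domRestrict_apply, ← hl v, ← Module.End.coe_pow,
      Module.End.pow_restrict, LinearMap.coe_restrict_apply, Module.End.coe_pow]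
  have hzero_s : l.domRestrict Es = 0 := by
    refine dual_eq_zero_of_forall_norm_map_lt (fun v hv => ?_) hj (hrestrict hEs)
    obtain ⟨u, hu, hvu⟩ := exists_unit_smul hv
    rw [hvu, map_smul, norm_smul, norm_smul, hu]
    exact mul_lt_mul_of_pos_left (hcontr u u.2 hu) (by simpa using hv)
  have hzero_u : l.domRestrict Eu = 0 := by
    refine dual_eq_zero_of_forall_lt_norm_map (fun v hv => ?_) hj (hrestrict hEu)
    obtain ⟨u, hu, hvu⟩ := exists_unit_smul hv
    rw [hvu, map_smul, norm_smul, norm_smul, hu]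
    exact mul_lt_mul_of_pos_left (hexp u u.2 hu) (by simpa using hv)
  rw [← LinearMap.ker_eq_top, ← top_le_iff, ← hE]
  exact sup_le (fun v hv => LinearMap.mem_ker.2 (DFunLike.congr_fun hzero_s ⟨v, hv⟩))
    fun v hv => LinearMap.mem_ker.2 (DFunLike.congr_fun hzero_u ⟨v, hv⟩)

end Hyperbolic

/-! ### Invariant functions of Anosov diffeomorphisms -/

theorem hasMFDerivAt_iterate_of_isFixedPt {𝕜 E H M : Type*} [NontriviallyNormedField 𝕜]
    [NormedAddCommGroup E] [NormedSpace 𝕜 E] [TopologicalSpace H] {I : ModelWithCorners 𝕜 E H}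
    [TopologicalSpace M] [ChartedSpace H M] {f : M → M} {x : M} (hx : Function.IsFixedPt f x)
    {L : TangentSpace I x →L[𝕜] TangentSpace I x} (hL : HasMFDerivAt I I f x L) (i : ℕ) :
    HasMFDerivAt I I f^[i] x (L ^ i) := by
  induction i with
  | zero => exact hasMFDerivAt_id x
  | succ i ih =>
    rw [Function.iterate_succ', pow_succ']
    have hLi : HasMFDerivAt I I f (f^[i] x) L := by
      rw [hx.iterate i]
      exact hL
    exact hLi.comp x ih

section Anosov

variable {m : ℕ} {M : Type*} [TopologicalSpace M] [ChartedSpace (EuclideanSpace ℝ (Fin m)) M]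
  [IsManifold (𝓡 m) ∞ M] {f : M → M}

open scoped Bundle in
theorem IsAnosov.dual_eq_zero (hf : IsAnosov (m := m) f) {x₀ : M} (hfix : Function.IsFixedPt f x₀)
    {L : TangentSpace (𝓡 m) x₀ →L[ℝ] TangentSpace (𝓡 m) x₀}
    (hL : HasMFDerivAt (𝓡 m) (𝓡 m) f x₀ L) {j : ℕ} (hj : j ≠ 0)
    {l : Module.Dual ℝ (TangentSpace (𝓡 m) x₀)} (hl : ∀ v, l (L^[j] v) = l v) : l = 0 := by
  obtain ⟨g, Es, Eu, hE, -, -, hs, hu, k, -, hk⟩ := hf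
  let : Bundle.RiemannianBundle (fun x : M => TangentSpace (𝓡 m) x) :=
    ⟨g.toContinuousRiemannianMetric.toRiemannianMetric⟩
  have inner_self {y : M} (hy : y = x₀) (v : TangentSpace (𝓡 m) x₀) :
      g.inner y (show TangentSpace (𝓡 m) y from v) (show TangentSpace (𝓡 m) y from v) =
        ‖v‖ ^ 2 := by
    subst hy
    exact real_inner_self_eq_norm_sq v
  have maps_fiber {S : ∀ x : M, Submodule ℝ (TangentSpace (𝓡 m) x)}
      (hS : (S x₀).map (mfderiv (𝓡 m) (𝓡 m) f x₀).toLinearMap = S (f x₀)) (i : ℕ) :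
      ∀ v ∈ S x₀, (L ^ i) v ∈ S x₀ := by
    have hS' : (S x₀).map L.toLinearMap = S x₀ := by
      rw [hL.mfderiv] at hS
      have fiber {y : M} (hy : y = x₀) : (S y : Submodule ℝ (EuclideanSpace ℝ (Fin m))) = S x₀ := by
        rw [hy]
      exact hS.trans (fiber hfix)
    intro v hv
    rw [FunLike.coe_pow_eq_iterate]
    exact Set.MapsTo.iterate (fun w hw => hS' ▸ Submodule.mem_map_of_mem hw) i hv
  have hLk : mfderiv (𝓡 m) (𝓡 m) f^[k] x₀ = L ^ k :=
    (hasMFDerivAt_iterate_of_isFixedPt hfix hL k).mfderiv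
  have hcontr := (hk x₀).1
  have hexp := (hk x₀).2
  rw [hLk] at hcontr hexp
  have : FiniteDimensional ℝ (TangentSpace (𝓡 m) x₀) :=
    inferInstanceAs (FiniteDimensional ℝ (EuclideanSpace ℝ (Fin m)))
  refine dual_eq_zero_of_hyperbolic (A := (L ^ k).toLinearMap) (hE x₀).sup_eq_top
    (maps_fiber (hs x₀) k) (maps_fiber (hu x₀) k) (fun v hv hv1 => ?_) (fun v hv hv1 => ?_) hj
    fun v => ?_
  · have := hcontr v hv (by rw [inner_self rfl, hv1, one_pow])
    exact (sq_lt_one_iff₀ (norm_nonneg _)).1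
      ((inner_self (hfix.iterate k) ((L ^ k) v)).symm.trans_lt this)
  · have := hexp v hv (by rw [inner_self rfl, hv1, one_pow])
    exact (one_lt_sq_iff₀ (norm_nonneg _)).1
      (this.trans_eq (inner_self (hfix.iterate k) ((L ^ k) v)))
  · have hiter := (show Function.Semiconj l L^[j] id from hl).iterate_right k v
    rw [Function.iterate_id, ← Function.iterate_mul, mul_comm, Function.iterate_mul] at hiter
    rwa [ContinuousLinearMap.coe_coe, FunLike.coe_pow_eq_iterate]

theorem IsAnosov.hasMFDerivAt_zero_of_invariant (hf : IsAnosov (m := m) f) {x₀ : M}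
    (hfd : MDifferentiableAt (𝓡 m) (𝓡 m) f x₀) (hfix : Function.IsFixedPt f x₀) {j : ℕ}
    (hj : j ≠ 0) {Y : M → ℝ} (hY : MDifferentiableAt (𝓡 m) 𝓘(ℝ, ℝ) Y x₀)
    (hYf : ∀ᶠ x in 𝓝 x₀, Y (f^[j] x) = Y x) : HasMFDerivAt (𝓡 m) 𝓘(ℝ, ℝ) Y x₀ 0 := by
  let V := TangentSpace (𝓡 m) x₀
  let L : V →L[ℝ] V := mfderiv (𝓡 m) (𝓡 m) f x₀
  have hL : HasMFDerivAt (𝓡 m) (𝓡 m) f x₀ L := hfd.hasMFDerivAt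
  let l : V →L[ℝ] ℝ := mfderiv (𝓡 m) 𝓘(ℝ, ℝ) Y x₀
  have hl : HasMFDerivAt (𝓡 m) 𝓘(ℝ, ℝ) Y x₀ l := hY.hasMFDerivAt
  have hlL : l ∘L L ^ j = l := by
    have hl' : HasMFDerivAt (𝓡 m) 𝓘(ℝ, ℝ) Y (f^[j] x₀) l := by
      rw [hfix.iterate j]
      exact hl
    exact hasMFDerivAt_unique ((hl'.comp x₀ (hasMFDerivAt_iterate_of_isFixedPt hfix hL j)
      ).congr_of_eventuallyEq (hYf.mono fun x hx => hx.symm)) hl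
  have hzero : l.toLinearMap = 0 := hf.dual_eq_zero hfix hL hj fun v => by
    simpa [FunLike.coe_pow_eq_iterate] using DFunLike.congr_fun hlL v
  rwa [show l = 0 from ContinuousLinearMap.coe_injective hzero] at hl

end Anosov

section DerivativeOfHom

variable {E H : Type*} [NormedAddCommGroup E] [NormedSpace ℝ E] [TopologicalSpace H]
  {I : ModelWithCorners ℝ E H}

theorem eventually_eq_of_eventually_hasFDerivAt_zero {F : Type*} [NormedAddCommGroup F]
    [NormedSpace ℝ F] {f : E → F} {x : E} (hf : ∀ᶠ y in 𝓝 x, HasFDerivAt f (0 : E →L[ℝ] F) y) :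
    ∀ᶠ y in 𝓝 x, f y = f x := by
  obtain ⟨r, hr, hball⟩ := Metric.mem_nhds_iff.1 hf
  filter_upwards [Metric.ball_mem_nhds x hr] with y hy
  exact Metric.isOpen_ball.is_const_of_fderiv_eq_zero (𝕜 := ℝ) (convex_ball x r).isPreconnected
    (fun z hz => (hball hz).differentiableAt.differentiableWithinAt)
    (fun z hz => (hball hz).fderiv) hy (Metric.mem_ball_self hr)

theorem eventually_eq_of_forall_hasMFDerivAt_zero [I.Boundaryless] {M F : Type*}
    [TopologicalSpace M] [ChartedSpace H M] [IsManifold I 1 M] [NormedAddCommGroup F]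
    [NormedSpace ℝ F] {f : M → F} (hf : ∀ x, HasMFDerivAt I 𝓘(ℝ, F) f x 0) (x : M) :
    ∀ᶠ y in 𝓝 x, f y = f x := by
  let e := extChartAt I x
  have hderiv : ∀ᶠ ξ in 𝓝 (e x), HasFDerivAt (f ∘ e.symm) (0 : E →L[ℝ] F) ξ := by
    filter_upwards [eventually_eventually_nhds.2 (extChartAt_target_mem_nhds (I := I) x)] with ξ hξ
    have hsymm : MDifferentiableAt 𝓘(ℝ, E) I e.symm ξ :=
      ((contMDiffOn_extChartAt_symm (n := 1) x).contMDiffAt hξ).mdifferentiableAt one_ne_zero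
    have hcomp := (hf (e.symm ξ)).comp ξ hsymm.hasMFDerivAt
    rw [hasMFDerivAt_iff_hasFDerivAt] at hcomp
    convert! hcomp using 1
  filter_upwards [extChartAt_source_mem_nhds (I := I) x,
    (continuousAt_extChartAt (I := I) x).eventually
      (eventually_eq_of_eventually_hasFDerivAt_zero hderiv)] with y hy hconst
  rwa [Function.comp_apply, Function.comp_apply, e.left_inv hy,
    e.left_inv (mem_extChartAt_source x)] at hconst

variable {G : Type*} [Group G] [TopologicalSpace G] [ChartedSpace H G] {X : G →* Multiplicative ℝ}

theorem hasMFDerivAt_hom_real_zero [ContMDiffMul I 1 G]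
    (hX : HasMFDerivAt I 𝓘(ℝ, ℝ) (fun g => (X g).toAdd) 1 0) (g : G) :
    HasMFDerivAt I 𝓘(ℝ, ℝ) (fun g => (X g).toAdd) g 0 := by
  have htranslate : MDifferentiableAt I I (fun u => g⁻¹ * u) g :=
    (contMDiff_mul_left (n := 1) (a := g⁻¹)).mdifferentiableAt one_ne_zero
  have hX' : HasMFDerivAt I 𝓘(ℝ, ℝ) (fun g => (X g).toAdd) (g⁻¹ * g) 0 := by
    rwa [inv_mul_cancel]
  have hsum := (hX'.comp g htranslate.hasMFDerivAt).add
    (hasMFDerivAt_const (I := I) (I' := 𝓘(ℝ, ℝ)) (X g).toAdd g)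
  exact (hsum.congr_of_eventuallyEq (f₁ := fun g => (X g).toAdd)
    (Filter.Eventually.of_forall fun u => by simp)).congr_mfderiv
      ((add_zero _).trans (ContinuousLinearMap.zero_comp _))

theorem hom_real_eq_one_of_hasMFDerivAt_zero [I.Boundaryless] [LieGroup I 1 G] [ConnectedSpace G]
    (hX : HasMFDerivAt I 𝓘(ℝ, ℝ) (fun g => (X g).toAdd) 1 0) : X = 1 := by
  have : IsTopologicalGroup G := topologicalGroup_of_lieGroup I 1
  have hnhds : (X.ker : Set G) ∈ 𝓝 1 := by
    filter_upwards [eventually_eq_of_forall_hasMFDerivAt_zero (hasMFDerivAt_hom_real_zero hX) 1]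
      with u hu
    simpa using hu
  have hopen := X.ker.isOpen_of_mem_nhds hnhds
  have htop : (X.ker : Set G) = Set.univ :=
    IsClopen.eq_univ ⟨X.ker.isClosed_of_isOpen hopen, hopen⟩ ⟨1, one_mem _⟩
  exact X.ker_eq_top_iff.1 (SetLike.coe_injective htop)

end DerivativeOfHom

/- On the chart `p` at `1`, the homomorphism `X` becomes a function near the fixed point `p 1` that
is invariant under the iterate of `f`. -/
theorem IsAnosov.hom_real_eq_one {m : ℕ} {M : Type*} [TopologicalSpace M]
    [ChartedSpace (EuclideanSpace ℝ (Fin m)) M] [IsManifold (𝓡 m) ∞ M] {f : M → M}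
    (hf : IsAnosov (m := m) f) {G : Type*} [Group G] [TopologicalSpace G]
    [ChartedSpace (EuclideanSpace ℝ (Fin m)) G] [LieGroup (𝓡 m) 1 G] [ConnectedSpace G]
    {n : WithTop ℕ∞} (hn : n ≠ 0)
    {p : G → M} (hp : IsLocalDiffeomorphAt (𝓡 m) (𝓡 m) n p 1)
    (hfd : MDifferentiableAt (𝓡 m) (𝓡 m) f (p 1)) (hfix : Function.IsFixedPt f (p 1))
    {B : G →* G} (hB : Continuous B) {j : ℕ} (hj : j ≠ 0) (hconj : Function.Semiconj p B f^[j])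
    {X : G →* Multiplicative ℝ}
    (hX : MDifferentiableAt (𝓡 m) 𝓘(ℝ, ℝ) (fun g => (X g).toAdd) 1) (hXB : X.comp B = X) :
    X = 1 := by
  let s := hp.localInverse
  let Y : M → ℝ := fun x => (X (s x)).toAdd
  have hs : MDifferentiableAt (𝓡 m) (𝓡 m) s (p 1) :=
    hp.localInverse_mdifferentiableAt hn
  have hs1 : s (p 1) = 1 := hp.localInverse_left_inv hp.localInverse_mem_target
  have hsp : ∀ᶠ u in 𝓝 1, s (p u) = u := hp.localInverse_eventuallyEq_left
  have hps : ∀ᶠ x in 𝓝 (p 1), p (s x) = x := hp.localInverse_eventuallyEq_right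
  have hY : MDifferentiableAt (𝓡 m) 𝓘(ℝ, ℝ) Y (p 1) := by
    have hX' : MDifferentiableAt (𝓡 m) 𝓘(ℝ, ℝ) (fun g => (X g).toAdd) (s (p 1)) := by rwa [hs1]
    exact hX'.comp (p 1) hs
  have hBs : Filter.Tendsto (fun x => B (s x)) (𝓝 (p 1)) (𝓝 1) := by
    have hBs' := (hB.tendsto (s (p 1))).comp hs.continuousAt
    rwa [hs1, map_one] at hBs'
  have hYf : ∀ᶠ x in 𝓝 (p 1), Y (f^[j] x) = Y x := by
    filter_upwards [hps, hBs.eventually hsp] with x hx hBx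
    have hXx : X (B (s x)) = X (s x) := DFunLike.congr_fun hXB (s x)
    simp only [Y]
    rw [← hXx, ← hBx, hconj (s x), hx]
  have hY0 := hf.hasMFDerivAt_zero_of_invariant hfd hfix hj hY hYf
  have hXp := (hY0.comp 1 (hp.mdifferentiableAt hn).hasMFDerivAt).congr_of_eventuallyEq
    (f₁ := fun g => (X g).toAdd) (hsp.mono fun u hu => by simp only [Function.comp_apply, Y, hu])
  refine hom_real_eq_one_of_hasMFDerivAt_zero (I := 𝓡 m) ?_
  convert! hXp using 1

/-! ### Monodromy -/

theorem monodromy_map_eq {E X E' X' : Type*} [TopologicalSpace E] [TopologicalSpace X]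
    [TopologicalSpace E'] [TopologicalSpace X'] {p : E → X} {p' : E' → X'} (hp : IsCoveringMap p)
    (hp' : IsCoveringMap p') {F' : C(E, E')} {F : C(X, X')} (hF : ∀ e, p' (F' e) = F (p e))
    {x y : X} (σ : Path.Homotopic.Quotient x y) (e : p ⁻¹' {x}) :
    (hp'.monodromy (σ.map F) ⟨F' e, by simp [hF, show p e = x from e.2]⟩ : E') =
      F' (hp.monodromy σ e) := by
  obtain ⟨e, rfl⟩ := e
  obtain ⟨σ⟩ := σ
  change hp'.liftPath _ _ _ 1 = F' (hp.liftPath _ _ _ 1)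
  rw [← (hp'.eq_liftPath_iff' _ (Γ := F'.comp (hp.liftPath σ e σ.source))).2 ⟨?_, ?_⟩]
  · rfl
  · ext t
    have hlift := congrFun (hp.liftPath_lifts (σ : C(unitInterval, X)) e σ.source) t
    simp only [Function.comp_apply, ContinuousMap.comp_apply, hF] at hlift ⊢
    rw [hlift]
    rfl
  · simp [hp.liftPath_zero]

theorem monodromy_mapOfEq_eq {E X E' X' : Type*} [TopologicalSpace E] [TopologicalSpace X]
    [TopologicalSpace E'] [TopologicalSpace X'] {p : E → X} {p' : E' → X'} (hp : IsCoveringMap p)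
    (hp' : IsCoveringMap p') {F' : C(E, E')} {F : C(X, X')} (hF : ∀ e, p' (F' e) = F (p e))
    {x : X} {y : X'} (hxy : F x = y) (σ : FundamentalGroup X x) (e : p ⁻¹' {x}) (e' : p' ⁻¹' {y})
    (he : F' e = e') :
    (hp'.monodromy (FundamentalGroup.mapOfEq F hxy σ) e' : E') = F' (hp.monodromy σ e) := by
  subst hxy
  obtain rfl : e' = ⟨F' e, by simp [hF, show p e = x from e.2]⟩ := Subtype.ext he.symm
  rw [FundamentalGroup.mapOfEq_apply, Path.Homotopic.Quotient.cast_rfl_rfl]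
  exact monodromy_map_eq hp hp' hF σ e

theorem mapOfEq_mapOfEq {X Y Z : Type*} [TopologicalSpace X] [TopologicalSpace Y]
    [TopologicalSpace Z] {f : C(X, Y)} {g : C(Y, Z)} {x : X} {y : Y} {z : Z} (hf : f x = y)
    (hg : g y = z) (σ : FundamentalGroup X x) :
    FundamentalGroup.mapOfEq g hg (FundamentalGroup.mapOfEq f hf σ) =
      FundamentalGroup.mapOfEq (g.comp f) (by simp [hf, hg]) σ := by
  subst hf hg
  simp only [FundamentalGroup.mapOfEq_apply]
  obtain ⟨σ⟩ := σ
  rfl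

theorem mapOfEq_mapOfEq_comm {X Y Y' Z : Type*} [TopologicalSpace X] [TopologicalSpace Y]
    [TopologicalSpace Y'] [TopologicalSpace Z] {f : C(X, Y)} {g : C(Y, Z)} {f' : C(X, Y')}
    {g' : C(Y', Z)} (h : g.comp f = g'.comp f') {x : X} {y : Y} {y' : Y'} {z : Z} (hf : f x = y)
    (hg : g y = z) (hf' : f' x = y') (hg' : g' y' = z) (σ : FundamentalGroup X x) :
    FundamentalGroup.mapOfEq g hg (FundamentalGroup.mapOfEq f hf σ) =
      FundamentalGroup.mapOfEq g' hg' (FundamentalGroup.mapOfEq f' hf' σ) := by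
  rw [mapOfEq_mapOfEq, mapOfEq_mapOfEq]
  congr 2

theorem finiteIndex_range_mapOfEq_of_finite_fiber {E X : Type*} [TopologicalSpace E]
    [TopologicalSpace X] {p : E → X} (hp : IsCoveringMap p) {x : X} {e : E} (he : p e = x)
    (hfin : (p ⁻¹' {x}).Finite) :
    (FundamentalGroup.mapOfEq (⟨p, hp.continuous⟩ : C(E, X)) he).range.FiniteIndex := by
  let := hp.fundamentalGroupMulAction x
  have : Finite (p ⁻¹' {x}) := hfin
  let e' : p ⁻¹' {x} := ⟨e, he⟩
  have : (MulAction.stabilizer (FundamentalGroup X x) e').FiniteIndex := by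
    rw [Subgroup.finiteIndex_iff_finite_quotient]
    exact Finite.of_equiv _ (MulAction.orbitEquivQuotientStabilizer (FundamentalGroup X x) e')
  refine Subgroup.finiteIndex_of_le (H := MulAction.stabilizer (FundamentalGroup X x) e') ?_
  intro σ (hσ : hp.monodromy σ e' = e')
  refine ⟨(hp.liftPathQuotient σ e').cast rfl (congrArg Subtype.val hσ.symm), ?_⟩
  rw [FundamentalGroup.mapOfEq_apply, Path.Homotopic.Quotient.map_cast,
    IsCoveringMap.map_liftPathQuotient, Path.Homotopic.Quotient.cast_cast]
  exact (Path.Homotopic.Quotient.cast_cast (X := X) σ _ _ _ _).trans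
    (Path.Homotopic.Quotient.cast_rfl_rfl (X := X) σ)

/-! ### Displacement subgroups of finite index -/

theorem displacementSubgroup_le_ker {ι P Q : Type*} [Group P] [Group Q] {F : ι → P →* P}
    {χ : P →* Q} (hχ : ∀ i σ, χ (F i σ) = χ σ) : displacementSubgroup F ≤ χ.ker := by
  refine (Subgroup.closure_le _).2 ?_
  rintro _ ⟨i, σ, rfl⟩
  rw [SetLike.mem_coe, MonoidHom.mem_ker, map_mul, hχ, map_inv, mul_inv_cancel]

theorem finiteIndex_displacementSubgroup {ι P : Type*} [Group P] [Group.IsNilpotent P]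
    [Group.FG P] {F : ι → P →* P}
    (hF : ∀ χ : P →* Multiplicative ℝ, (∀ i σ, χ (F i σ) = χ σ) → χ = 1) :
    (displacementSubgroup F).FiniteIndex := by
  rw [Subgroup.finiteIndex_iff_finite_quotient]
  refine finite_of_isNilpotent_of_forall_hom_real_eq_one _ fun f => QuotientGroup.monoidHom_ext _ ?_
  refine hF (f.comp (QuotientGroup.mk' _)) fun i σ => congrArg f ?_
  rw [← mul_inv_eq_one, ← map_inv, ← map_mul]
  exact (QuotientGroup.eq_one_iff _).2 (Subgroup.subset_closure ⟨i, σ, rfl⟩)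

theorem finiteIndex_displacementSubgroup_of_semiconj {ι κ P Q : Type*} [Group P] [Group Q]
    {F : ι → P →* P} {F' : κ → Q →* Q} {φ : P →* Q} (hφ : φ.range.FiniteIndex)
    (hF : (displacementSubgroup F).FiniteIndex)
    (hFF' : ∀ i, ∃ i', ∀ σ, φ (F i σ) = F' i' (φ σ)) : (displacementSubgroup F').FiniteIndex := by
  have hmap : ((displacementSubgroup F).map φ).FiniteIndex := by
    refine ⟨?_⟩
    rw [Subgroup.index_map]
    exact mul_ne_zero (Subgroup.finiteIndex_of_le
      (le_sup_left : displacementSubgroup F ≤ _ ⊔ φ.ker)).index_ne_zero hφ.index_ne_zero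
  refine Subgroup.finiteIndex_of_le (H := (displacementSubgroup F).map φ) ?_
  rw [Subgroup.map_le_iff_le_comap, displacementSubgroup, Subgroup.closure_le]
  rintro _ ⟨i, σ, rfl⟩
  obtain ⟨i', hi'⟩ := hFF' i
  refine Subgroup.subset_closure ⟨i', φ σ, ?_⟩
  rw [map_mul, map_inv, hi']

/-! ### Affine automorphisms with a fixed point -/

theorem iterate_mul_map_mul {G : Type*} [Group G] (A : G →* G) (g x u : G) (i : ℕ) :
    (fun y => g * A y)^[i] (x * u) = (fun y => g * A y)^[i] x * A^[i] u := by
  induction i with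
  | zero => rfl
  | succ i ih => simp only [Function.iterate_succ_apply', ih, map_mul, mul_assoc]

theorem mem_periodicPts_of_finite_fiber {X Y : Type*} {p : X → Y} {T : X → X} {f : Y → Y}
    (hT : Function.Injective T) (hp : Function.Semiconj p T f) {x : X}
    (hx : Function.IsFixedPt f (p x)) (hfin : (p ⁻¹' {p x}).Finite) :
    x ∈ Function.periodicPts T := by
  have : Finite (p ⁻¹' {p x}) := hfin
  have hmaps : Set.MapsTo T (p ⁻¹' {p x}) (p ⁻¹' {p x}) := fun y (hy : p y = p x) => by
    rw [Set.mem_preimage, Set.mem_singleton_iff, hp y, hy, hx]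
  obtain ⟨j, hj, hperiodic⟩ :=
    (hmaps.restrict_inj.2 hT.injOn).mem_periodicPts ⟨x, rfl⟩
  exact ⟨j, hj, hperiodic.map (g := Subtype.val) fun _ => rfl⟩

theorem exists_iterate_mem_of_finite_fiber {G X : Type*} [Group G] {Γ : Subgroup G} {A : G ≃* G}
    (hA : ∀ γ, A γ ∈ Γ ↔ γ ∈ Γ) {g q : G} {p : G ⧸ Γ → X} {f : X → X}
    (hp : ∀ x : G, f (p x) = p ((g * A x : G) : G ⧸ Γ)) (hfix : Function.IsFixedPt f (p q))
    (hfin : (p ⁻¹' {p q}).Finite) : ∃ j ≠ 0, q⁻¹ * (fun x => g * A x)^[j] q ∈ Γ := by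
  let T : G → G := fun x => g * A x
  let Tbar : G ⧸ Γ → G ⧸ Γ := Quotient.map' T fun x y hxy => by
    rw [QuotientGroup.leftRel_apply] at hxy ⊢
    simpa [T, mul_assoc] using (hA _).2 hxy
  have hTbar : Function.Injective Tbar := by
    rintro ⟨x⟩ ⟨y⟩ hxy
    refine QuotientGroup.eq.2 ((hA _).1 ?_)
    simpa [T, mul_assoc] using QuotientGroup.eq.1 hxy
  have hTbar_p : Function.Semiconj p Tbar f := by
    rintro ⟨x⟩
    exact (hp x).symm
  have hmk : Function.Semiconj ((↑) : G → G ⧸ Γ) T Tbar := fun _ => rfl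
  obtain ⟨j, hj, hq⟩ := mem_periodicPts_of_finite_fiber hTbar hTbar_p hfix hfin
  exact ⟨j, hj.ne', QuotientGroup.eq.1 (hq.symm.trans (hmk.iterate_right j q).symm)⟩

/-- The map `uΓ ↦ B(u)Γ` of `G ⧸ Γ` induced by an endomorphism `B` of `G` preserving `Γ`. -/
def quotientMap {G : Type*} [Group G] [TopologicalSpace G] {Γ : Subgroup G} {B : G →* G}
    (hB : Continuous B) (hBΓ : ∀ γ ∈ Γ, B γ ∈ Γ) : C(G ⧸ Γ, G ⧸ Γ) where
  toFun := Quotient.map' B fun x y hxy => QuotientGroup.leftRel_apply.2 (by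
    simpa using hBΓ _ (QuotientGroup.leftRel_apply.1 hxy))
  continuous_toFun := hB.quotient_map' _

theorem quotientMap_one {G : Type*} [Group G] [TopologicalSpace G] {Γ : Subgroup G} {B : G →* G}
    (hB : Continuous B) (hBΓ : ∀ γ ∈ Γ, B γ ∈ Γ) :
    quotientMap hB hBΓ ((1 : G) : G ⧸ Γ) = ((1 : G) : G ⧸ Γ) :=
  congrArg _ (map_one B)

section Affine

variable {m : ℕ} {M : Type*} [TopologicalSpace M] [ChartedSpace (EuclideanSpace ℝ (Fin m)) M]

/-- The covering `uΓ ↦ p(quΓ)`, which moves the point `p(qΓ)` under the base point `Γ`. -/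
def NilmanifoldCover.translate (C : NilmanifoldCover m M) (q : C.G) : NilmanifoldCover m M :=
  have : IsTopologicalGroup C.G := topologicalGroup_of_lieGroup (𝓡 m) ∞
  let L : C.G ≃ₘ^∞⟮𝓡 m, 𝓡 m⟯ C.G :=
    { toEquiv := Equiv.mulLeft q
      contMDiff_toFun := contMDiff_mul_left
      contMDiff_invFun := contMDiff_mul_left }
  { C with
    p := fun u => C.p (q • u)
    isCoveringMap := C.isCoveringMap.comp_homeomorph (Homeomorph.smul q)
    surjective := C.surjective.comp (MulAction.surjective q)
    finite_fiber := fun x => Set.Finite.preimage (f := fun u : C.G ⧸ C.Γ => q • u)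
      (MulAction.injective q).injOn (C.finite_fiber x)
    isLocalDiffeomorph := fun u =>
      (L.isLocalDiffeomorph u).comp (𝓡 m) M (C.isLocalDiffeomorph (q * u)) }

/- Write `T x = g A(x)`. The fiber over `x₀` is finite, so `T^[j]` fixes a point `qΓ` of it for some
`j > 0`, i.e. `T^[j] q = q γ` with `γ ∈ Γ`, and then `T^[j] (q u) = q (γ A^[j](u) γ⁻¹) γ`. -/
theorem IsAffineAutomorphism.exists_semiconj {f : M → M} (hf : IsAffineAutomorphism m f) {x₀ : M}
    (hfix : Function.IsFixedPt f x₀) :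
    ∃ (C : NilmanifoldCover m M) (B : C.G →* C.G) (j : ℕ), j ≠ 0 ∧ Continuous B ∧
      (∀ γ ∈ C.Γ, B γ ∈ C.Γ) ∧ C.p (1 : C.G) = x₀ ∧
      Function.Semiconj (fun u : C.G => C.p u) B f^[j] := by
  obtain ⟨C, A, g, hΓ, hf⟩ := hf
  have : IsTopologicalGroup C.G := topologicalGroup_of_lieGroup (𝓡 m) ∞
  have mem_iff (γ) : A γ ∈ C.Γ ↔ γ ∈ C.Γ := by
    conv_lhs => rw [← hΓ]
    exact Subgroup.mem_map_iff_mem (f := (A : C.G →* C.G)) A.injective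
  let T : C.G → C.G := fun x => g * A x
  have hT_semiconj : Function.Semiconj (fun x : C.G => C.p x) T f := fun x => (hf x).symm
  obtain ⟨⟨q⟩, rfl⟩ := C.surjective x₀
  obtain ⟨j, hj, hγ⟩ : ∃ j ≠ 0, q⁻¹ * T^[j] q ∈ C.Γ :=
    exists_iterate_mem_of_finite_fiber (A := A.toMulEquiv) mem_iff hf hfix (C.finite_fiber _)
  set γ := q⁻¹ * T^[j] q with hγ_def
  let Aj : Monoid.End C.G := (show Monoid.End C.G from (A : C.G →* C.G)) ^ j
  have coe_Aj : ⇑Aj = A^[j] := Monoid.End.coe_pow C.G (A : C.G →* C.G) j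
  refine ⟨C.translate q, (MulAut.conj γ).toMonoidHom.comp Aj, j, hj, ?_, fun η hη => ?_,
    congrArg C.p (congrArg _ (mul_one q)), fun (u : C.G) => ?_⟩
  · change Continuous fun u => γ * Aj u * γ⁻¹
    rw [coe_Aj]
    exact (continuous_const.mul (A.continuous.iterate j)).mul continuous_const
  · have hAj : Aj η ∈ C.Γ := by
      rw [coe_Aj]
      exact Set.MapsTo.iterate (s := (C.Γ : Set C.G)) (fun η hη => (mem_iff η).2 hη) j hη
    exact mul_mem (mul_mem hγ hAj) (inv_mem hγ)
  · have hT : T^[j] (q * u) = q * (γ * Aj u) := by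
      rw [coe_Aj, hγ_def, ← mul_assoc, mul_inv_cancel_left]
      exact iterate_mul_map_mul (A : C.G →* C.G) g q u j
    calc C.p ((q * (γ * Aj u * γ⁻¹) : C.G) : C.G ⧸ C.Γ)
        = C.p ((T^[j] (q * u) : C.G) : C.G ⧸ C.Γ) := by
          rw [hT]
          exact congrArg C.p (QuotientGroup.eq.2 (by simpa [mul_assoc] using hγ))
      _ = f^[j] (C.p ((q * u : C.G) : C.G ⧸ C.Γ)) := hT_semiconj.iterate_right j _

end Affine

/-! ### The displacement subgroup of an affine Anosov action -/

theorem exists_fundamentalGroup_mulEquiv {G : Type*} [Group G] [TopologicalSpace G]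
    [IsTopologicalGroup G] [SimplyConnectedSpace G] (Γ : Subgroup G) [DiscreteTopology Γ] :
    ∃ ε : FundamentalGroup (G ⧸ Γ) (1 : G) ≃* Γ,
      ∀ {B : G →* G} (hB : Continuous B) (hBΓ : ∀ γ ∈ Γ, B γ ∈ Γ) σ,
        (ε (FundamentalGroup.mapOfEq (quotientMap hB hBΓ) (quotientMap_one hB hBΓ) σ) : G) =
          B (ε σ) := by
  have hπ := Γ.isQuotientCoveringMap (isDiscrete_iff_discreteTopology.2 inferInstance)
  let e : ((↑) : G → G ⧸ Γ) ⁻¹' {((1 : G) : G ⧸ Γ)} := ⟨1, rfl⟩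
  let δ : (Γ.op)ᵐᵒᵖ ≃* Γ :=
    { toFun := fun z => ⟨z.unop.1.unop, z.unop.2⟩
      invFun := fun γ => MulOpposite.op ⟨MulOpposite.op γ.1, γ.2⟩
      left_inv := fun z => rfl
      right_inv := fun γ => rfl
      map_mul' := fun z w => rfl }
  let ε := (hπ.fundamentalGroupEquiv e).trans δ
  have coe_ε (σ) : (ε σ : G) = hπ.isCoveringMap.monodromy σ e :=
    (one_mul _).symm.trans (hπ.unop_fundamentalGroupToMulOpposite_smul (e := e))
  refine ⟨ε, fun {B} hB hBΓ σ => ?_⟩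
  rw [coe_ε, coe_ε]
  exact monodromy_mapOfEq_eq hπ.isCoveringMap hπ.isCoveringMap (F' := ⟨B, hB⟩) (fun _ => rfl) _ σ
    e e (map_one B)

section Anosov

variable {m : ℕ} {M : Type*} [TopologicalSpace M] [ChartedSpace (EuclideanSpace ℝ (Fin m)) M]
  [IsManifold (𝓡 m) ∞ M]

theorem IsAnosov.finiteIndex_displacementSubgroup {f : M → M} (hf : IsAnosov (m := m) f)
    (C : NilmanifoldCover m M) {B : C.G →* C.G} (hB : Continuous B) (hBΓ : ∀ γ ∈ C.Γ, B γ ∈ C.Γ)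
    (hfd : MDifferentiableAt (𝓡 m) (𝓡 m) f (C.p (1 : C.G)))
    (hfix : Function.IsFixedPt f (C.p (1 : C.G))) {j : ℕ} (hj : j ≠ 0)
    (hconj : Function.Semiconj (fun u : C.G => C.p u) B f^[j]) :
    (displacementSubgroup fun _ : Unit =>
      FundamentalGroup.mapOfEq (quotientMap hB hBΓ) (quotientMap_one hB hBΓ)).FiniteIndex := by
  have : IsTopologicalGroup C.G := topologicalGroup_of_lieGroup (𝓡 m) ∞
  have : LocallyCompactSpace C.G := Manifold.locallyCompact_of_finiteDimensional (𝓡 m)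
  have := C.discrete
  have := C.cocompact
  have : LieGroup (𝓡 m) 1 C.G := LieGroup.of_le (n := ∞) (by simp)
  have : Group.FG C.Γ := group_fg_of_discrete_of_cocompact C.Γ
  obtain ⟨ε, hε⟩ := exists_fundamentalGroup_mulEquiv C.Γ
  have : Group.FG (FundamentalGroup (C.G ⧸ C.Γ) (1 : C.G)) :=
    Group.fg_of_surjective ε.symm.surjective (f := ε.symm.toMonoidHom)
  have : Group.IsNilpotent (FundamentalGroup (C.G ⧸ C.Γ) (1 : C.G)) :=
    Group.nilpotent_of_mulEquiv ε.symm
  refine _root_.finiteIndex_displacementSubgroup fun χ hχ => ?_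
  obtain ⟨X, hXd, hX, hXB⟩ :=
    exists_hom_real_mdifferentiableAt (𝓡 m) C.Γ (χ.comp ε.symm.toMonoidHom)
  have hinv : X.comp B = X := by
    refine hXB B hB (fun γ => hBΓ γ γ.2) fun γ => ?_
    have hγ : (⟨B γ, hBΓ γ γ.2⟩ : C.Γ) = ε (FundamentalGroup.mapOfEq (quotientMap hB hBΓ)
        (quotientMap_one hB hBΓ) (ε.symm γ)) := Subtype.ext (by rw [hε, ε.apply_symm_apply])
    rw [hγ]
    exact (congrArg χ (ε.symm_apply_apply _)).trans (hχ () _)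
  have hχε := hX (hf.hom_real_eq_one (by simp) (C.isLocalDiffeomorph 1) hfd hfix hB hj hconj
    hXd hinv)
  ext σ
  simpa using DFunLike.congr_fun hχε (ε σ)

theorem finiteIndex_displacementSubgroup_of_isAnosov {k : ℕ} (α : IntLattice k →* Diff (𝓡 m) ∞ M)
    {a : IntLattice k} (ha_affine : IsAffineAutomorphism m (α a).1)
    (ha_anosov : IsAnosov (m := m) (α a).1) {x₀ : M} (hx₀ : ∀ a, (α a).1 x₀ = x₀) :
    (displacementSubgroup (inducedMap α hx₀)).FiniteIndex := by
  obtain ⟨C, B, j, hj, hB, hBΓ, rfl, hconj⟩ := ha_affine.exists_semiconj (hx₀ a)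
  refine finiteIndex_displacementSubgroup_of_semiconj
    (finiteIndex_range_mapOfEq_of_finite_fiber C.isCoveringMap rfl (C.finite_fiber _))
    (ha_anosov.finiteIndex_displacementSubgroup C hB hBΓ
      ((α a).2.1.mdifferentiable (by simp) _) (hx₀ a) hj hconj) fun _ => ⟨a ^ j, fun σ => ?_⟩
  refine mapOfEq_mapOfEq_comm (ContinuousMap.ext ?_) _ _ _ _ σ
  rintro ⟨u⟩
  have hpow : (α (a ^ j)).1 = (α a).1 ^ j := congrArg Subtype.val (map_pow α a j)
  exact (hconj u).trans (congrFun ((congrArg _ hpow).trans (Equiv.Perm.coe_pow _ _)) _).symm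

end Anosov

/-! ### Leaves of a horizontal foliation -/

theorem eq_ker_of_le_of_isCompl {K V E F : Type*} [DivisionRing K] [AddCommGroup V] [Module K V]
    [FiniteDimensional K V] [AddCommGroup E] [Module K E] [AddCommGroup F] [Module K F]
    {T : Submodule K V} {f : V →ₗ[K] E} {l : V →ₗ[K] F} (hf : Function.Surjective f)
    (hl : Function.Surjective l)
    (hdim : Module.finrank K V = Module.finrank K E + Module.finrank K F) (hle : T ≤ l.ker)
    (hcompl : IsCompl T f.ker) : T = l.ker := by
  have hT := Submodule.finrank_add_eq_of_isCompl hcompl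
  have hf' := LinearMap.finrank_range_add_finrank_ker f
  have hl' := LinearMap.finrank_range_add_finrank_ker l
  rw [LinearMap.range_eq_top.2 hf, finrank_top] at hf'
  rw [LinearMap.range_eq_top.2 hl, finrank_top] at hl'
  exact Submodule.eq_of_le_of_finrank_le hle (by omega)

namespace Foliation

section Charts

variable {E H : Type*} [NormedAddCommGroup E] [NormedSpace ℝ E] [TopologicalSpace H]
  {I : ModelWithCorners ℝ E H} {n : ℕ∞} {d c : ℕ} {X : Type*} [TopologicalSpace X]
  [ChartedSpace H X] {W : Foliation I n d c X}

/-- The map `γ` is continuous at `t` and runs in the leaf of `γ t` near `t`: the pointwise version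
of `Foliation.IsLeafwise`, for maps defined on an arbitrary space. -/
def LeafwiseAt (W : Foliation I n d c X) {Z : Type*} [TopologicalSpace Z] (γ : Z → X) (t : Z) :
    Prop :=
  ContinuousAt γ t ∧ ∀ φ ∈ W.atlas, γ t ∈ φ.source → ∀ᶠ s in 𝓝 t, (φ (γ s)).2 = (φ (γ t)).2

theorem LeafwiseAt.of_chart {Z : Type*} [TopologicalSpace Z] {γ : Z → X} {t : Z}
    (hγ : ContinuousAt γ t) {φ} (hφ : φ ∈ W.atlas) (ht : γ t ∈ φ.source)
    (hconst : ∀ᶠ s in 𝓝 t, (φ (γ s)).2 = (φ (γ t)).2) : W.LeafwiseAt γ t := by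
  refine ⟨hγ, fun ψ hψ htψ => ?_⟩
  obtain ⟨U, hU, hiff⟩ := W.compatible φ hφ ψ hψ (γ t) ⟨ht, htψ⟩
  filter_upwards [hconst, hγ hU] with s hs hsU
  exact (hiff _ hsU _ (mem_of_mem_nhds hU)).1 hs

theorem LeafwiseAt.comp {Z Z' : Type*} [TopologicalSpace Z] [TopologicalSpace Z'] {γ : Z → X}
    {f : Z' → Z} {t : Z'} (hγ : W.LeafwiseAt γ (f t)) (hf : ContinuousAt f t) :
    W.LeafwiseAt (γ ∘ f) t :=
  ⟨hγ.1.comp hf, fun φ hφ ht => hf.eventually (hγ.2 φ hφ ht)⟩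

theorem LeafwiseAt.congr {Z : Type*} [TopologicalSpace Z] {γ γ' : Z → X} {t : Z}
    (hγ : W.LeafwiseAt γ t) (h : γ' =ᶠ[𝓝 t] γ) : W.LeafwiseAt γ' t := by
  refine ⟨hγ.1.congr h.symm, fun φ hφ ht => ?_⟩
  rw [h.self_of_nhds] at ht ⊢
  filter_upwards [h, hγ.2 φ hφ ht] with s hs hs'
  rw [hs, hs']

theorem mdifferentiableAt_snd_chart (W : Foliation I n d c X) (hn : 1 ≤ n) {φ} (hφ : φ ∈ W.atlas)
    {z : X} (hz : z ∈ φ.source) :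
    MDifferentiableAt I 𝓘(ℝ, EuclideanSpace ℝ (Fin c)) (fun w => (φ w).2) z := by
  have hφz : MDifferentiableAt I
      𝓘(ℝ, EuclideanSpace ℝ (Fin d) × EuclideanSpace ℝ (Fin c)) φ z :=
    ((W.contMDiffOn φ hφ).contMDiffAt (φ.open_source.mem_nhds hz)).mdifferentiableAt
      (by simpa using (zero_lt_one.trans_le hn).ne')
  exact ((ContinuousLinearMap.snd ℝ (EuclideanSpace ℝ (Fin d))
    (EuclideanSpace ℝ (Fin c))).hasMFDerivAt.comp z hφz.hasMFDerivAt).mdifferentiableAt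

theorem mdifferentiableAt_chart_symm (W : Foliation I n d c X) (hn : 1 ≤ n) {φ} (hφ : φ ∈ W.atlas)
    {w} (hw : w ∈ φ.target) :
    MDifferentiableAt 𝓘(ℝ, EuclideanSpace ℝ (Fin d) × EuclideanSpace ℝ (Fin c)) I φ.symm w :=
  ((W.contMDiffOn_symm φ hφ).contMDiffAt (φ.open_target.mem_nhds hw)).mdifferentiableAt
    (by simpa using (zero_lt_one.trans_le hn).ne')

theorem mfderiv_snd_chart_mfderiv_symm (W : Foliation I n d c X) (hn : 1 ≤ n) {φ}
    (hφ : φ ∈ W.atlas) {w} (hw : w ∈ φ.target)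
    (v : EuclideanSpace ℝ (Fin d) × EuclideanSpace ℝ (Fin c)) :
    mfderiv I 𝓘(ℝ, EuclideanSpace ℝ (Fin c)) (fun w => (φ w).2) (φ.symm w)
      (mfderiv 𝓘(ℝ, EuclideanSpace ℝ (Fin d) × EuclideanSpace ℝ (Fin c)) I φ.symm w v) = v.2 := by
  have hcomp := ((W.mdifferentiableAt_snd_chart hn hφ (φ.map_target hw)).hasMFDerivAt.comp w
    (W.mdifferentiableAt_chart_symm hn hφ hw).hasMFDerivAt).congr_of_eventuallyEq (f₁ := Prod.snd)
    (by filter_upwards [φ.open_target.mem_nhds hw] with u hu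
        exact congrArg Prod.snd (φ.right_inv hu).symm)
  exact DFunLike.congr_fun (hasMFDerivAt_unique hcomp (ContinuousLinearMap.snd ℝ
    (EuclideanSpace ℝ (Fin d)) (EuclideanSpace ℝ (Fin c))).hasMFDerivAt) v

theorem tangent_le_ker (W : Foliation I n d c X) {φ} (hφ : φ ∈ W.atlas) {z : X}
    (hz : z ∈ φ.source) :
    W.tangent z ≤ (mfderiv I 𝓘(ℝ, EuclideanSpace ℝ (Fin c)) (fun w => (φ w).2) z).ker :=
  iInf_le_of_le φ (iInf_le_of_le hφ (iInf_le_of_le hz le_rfl))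

end Charts

variable {m q : ℕ} {n : ℕ∞} {M N : Type*} [TopologicalSpace M]
  [ChartedSpace (EuclideanSpace ℝ (Fin m)) M] [TopologicalSpace N]
  [ChartedSpace (EuclideanSpace ℝ (Fin q)) N]
  {W : Foliation ((𝓡 m).prod (𝓡 q)) n m q (M × N)}

theorem IsHorizontal.tangent_eq_ker (hW : W.IsHorizontal) (hn : 1 ≤ n) {φ} (hφ : φ ∈ W.atlas)
    {z : M × N} (hz : z ∈ φ.source) :
    W.tangent z =
      (mfderiv ((𝓡 m).prod (𝓡 q)) 𝓘(ℝ, EuclideanSpace ℝ (Fin q)) (fun w => (φ w).2) z).ker := by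
  let V := EuclideanSpace ℝ (Fin m) × EuclideanSpace ℝ (Fin q)
  let T : Submodule ℝ V := W.tangent z
  let f : V →ₗ[ℝ] EuclideanSpace ℝ (Fin m) :=
    (mfderiv ((𝓡 m).prod (𝓡 q)) (𝓡 m) (Prod.fst : M × N → M) z).toLinearMap
  let l : V →ₗ[ℝ] EuclideanSpace ℝ (Fin q) :=
    (mfderiv ((𝓡 m).prod (𝓡 q)) 𝓘(ℝ, EuclideanSpace ℝ (Fin q)) (fun w => (φ w).2) z).toLinearMap
  have hf : Function.Surjective f := fun v => by
    refine ⟨(v, 0), ?_⟩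
    change mfderiv ((𝓡 m).prod (𝓡 q)) (𝓡 m) (Prod.fst : M × N → M) z (v, 0) = v
    rw [mfderiv_fst]
    rfl
  have hl : Function.Surjective l := fun v => by
    have hv := W.mfderiv_snd_chart_mfderiv_symm hn hφ (φ.map_source hz) (0, v)
    rw [φ.left_inv hz] at hv
    exact ⟨_, hv⟩
  exact eq_ker_of_le_of_isCompl (T := T) hf hl Module.finrank_prod (W.tangent_le_ker hφ hz) (hW z)

theorem IsHorizontal.hasFDerivAt_snd_chart_comp_zero (hW : W.IsHorizontal) (hn : 1 ≤ n)
    {F : M × N → M × N} (hinv : W.IsInvariant F) {φ ψ} (hφ : φ ∈ W.atlas) (hψ : ψ ∈ W.atlas)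
    {w : EuclideanSpace ℝ (Fin m) × EuclideanSpace ℝ (Fin q)} (hw : w ∈ φ.target)
    (hF : MDifferentiableAt ((𝓡 m).prod (𝓡 q)) ((𝓡 m).prod (𝓡 q)) F (φ.symm w))
    (hFw : F (φ.symm w) ∈ ψ.source) :
    HasFDerivAt (fun a => (ψ (F (φ.symm (a, w.2)))).2)
      (0 : EuclideanSpace ℝ (Fin m) →L[ℝ] EuclideanSpace ℝ (Fin q)) w.1 := by
  have hcomp := HasMFDerivAt.comp (f := F ∘ φ.symm) w
    (W.mdifferentiableAt_snd_chart hn hψ hFw).hasMFDerivAt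
    (hF.hasMFDerivAt.comp w (W.mdifferentiableAt_chart_symm hn hφ hw).hasMFDerivAt)
  rw [hasMFDerivAt_iff_hasFDerivAt] at hcomp
  refine (HasFDerivAt.comp (f := fun a => (a, w.2)) w.1 hcomp
    (hasFDerivAt_prodMk_left w.1 w.2)).congr_fderiv (ContinuousLinearMap.ext fun v => ?_)
  have hv : mfderiv 𝓘(ℝ, EuclideanSpace ℝ (Fin m) × EuclideanSpace ℝ (Fin q))
      ((𝓡 m).prod (𝓡 q)) φ.symm w (v, 0) ∈ W.tangent (φ.symm w) := by
    rw [hW.tangent_eq_ker hn hφ (φ.map_target hw)]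
    exact W.mfderiv_snd_chart_mfderiv_symm hn hφ hw (v, 0)
  exact W.tangent_le_ker hψ hFw (hinv (φ.symm w) ▸ Submodule.mem_map_of_mem hv)

theorem IsHorizontal.leafwiseAt_comp (hW : W.IsHorizontal) (hn : 1 ≤ n) {F : M × N → M × N}
    (hF : ContMDiff ((𝓡 m).prod (𝓡 q)) ((𝓡 m).prod (𝓡 q)) 1 F) (hinv : W.IsInvariant F)
    {Z : Type*} [TopologicalSpace Z] {γ : Z → M × N} {t : Z} (hγ : W.LeafwiseAt γ t) :
    W.LeafwiseAt (F ∘ γ) t := by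
  obtain ⟨φ, hφ, hz⟩ := W.covers (γ t)
  obtain ⟨ψ, hψ, hz'⟩ := W.covers (F (γ t))
  refine LeafwiseAt.of_chart (hF.continuous.continuousAt.comp hγ.1) hψ hz' ?_
  let G : EuclideanSpace ℝ (Fin m) → EuclideanSpace ℝ (Fin q) :=
    fun a => (ψ (F (φ.symm (a, (φ (γ t)).2)))).2
  have hplaque : ContinuousAt (fun a => ((a, (φ (γ t)).2) : EuclideanSpace ℝ (Fin m) × _))
    (φ (γ t)).1 := by fun_prop
  have hFφ : ContinuousAt (F ∘ φ.symm) (φ (γ t)) :=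
    hF.continuous.continuousAt.comp (φ.continuousAt_symm (φ.map_source hz))
  have hG : ∀ᶠ a in 𝓝 (φ (γ t)).1,
      HasFDerivAt G (0 : EuclideanSpace ℝ (Fin m) →L[ℝ] EuclideanSpace ℝ (Fin q)) a := by
    filter_upwards [hplaque.eventually (φ.open_target.mem_nhds (φ.map_source hz)),
      hplaque.eventually (hFφ.eventually (ψ.open_source.mem_nhds
        (by rwa [Function.comp_apply, φ.left_inv hz])))] with a ha hFa
    exact hW.hasFDerivAt_snd_chart_comp_zero hn hinv hφ hψ ha
      (hF.mdifferentiableAt one_ne_zero) hFa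
  have hγ₁ : ContinuousAt (fun s => (φ (γ s)).1) t :=
    continuous_fst.continuousAt.comp ((φ.continuousAt hz).comp hγ.1)
  filter_upwards [hγ.2 φ hφ hz, hγ.1 (φ.open_source.mem_nhds hz),
    hγ₁.eventually (eventually_eq_of_eventually_hasFDerivAt_zero hG)] with s hs hsz hconst
  have hGs : G (φ (γ s)).1 = (ψ (F (γ s))).2 := by
    simp only [G]
    rw [← hs, φ.left_inv hsz]
  have hGt : G (φ (γ t)).1 = (ψ (F (γ t))).2 := by
    simp only [G]
    rw [φ.left_inv hz]
  exact hGs.symm.trans (hconst.trans hGt)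

end Foliation

/-! ### The inverse function theorem on manifolds -/

section InverseFunction

variable {E F H H' : Type*} [NormedAddCommGroup E] [NormedSpace ℝ E] [CompleteSpace E]
  [NormedAddCommGroup F] [NormedSpace ℝ F] [TopologicalSpace H] [TopologicalSpace H']
  {n : WithTop ℕ∞}

theorem isLocalDiffeomorphAt_of_hasFDerivAt_equiv {f : E → F} {f' : E ≃L[ℝ] F} {a : E}
    (hn : n ≠ 0) (hf : ∀ᶠ x in 𝓝 a, ContDiffAt ℝ n f x)
    (hf' : HasFDerivAt f (f' : E →L[ℝ] F) a) :
    IsLocalDiffeomorphAt 𝓘(ℝ, E) 𝓘(ℝ, F) n f a := by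
  have hfa : ContDiffAt ℝ n f a := hf.self_of_nhds
  have hequiv : ∀ᶠ x in 𝓝 a, fderiv ℝ f x ∈ Set.range ((↑) : (E ≃L[ℝ] F) → E →L[ℝ] F) :=
    (hfa.continuousAt_fderiv hn).eventually (hf'.fderiv.symm ▸ f'.nhds)
  obtain ⟨D, hD, hDo, haD⟩ := eventually_nhds_iff.1 (hf.and hequiv)
  let R := (hfa.toOpenPartialHomeomorph f hf' hn).restrOpen D hDo
  refine ⟨{ R.toPartialEquiv with
    open_source := R.open_source
    open_target := R.open_target
    contMDiffOn_toFun := fun x hx => (hD x hx.2).1.contMDiffAt.contMDiffWithinAt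
    contMDiffOn_invFun := fun y hy => ?_ },
    ⟨hfa.mem_toOpenPartialHomeomorph_source hf' hn, haD⟩, fun x _ => rfl⟩
  obtain ⟨hsmooth, e, he⟩ := hD _ (R.map_target hy).2
  refine (R.contDiffAt_symm (f₀' := e) hy ?_ hsmooth).contMDiffAt.contMDiffWithinAt
  exact he ▸ (hsmooth.differentiableAt hn).hasFDerivAt

variable {I : ModelWithCorners ℝ E H} {J : ModelWithCorners ℝ F H'}
  {X Y : Type*} [TopologicalSpace X] [ChartedSpace H X] [TopologicalSpace Y] [ChartedSpace H' Y]

omit [CompleteSpace E] in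
theorem isLocalDiffeomorphAt_congr {f g : X → Y} {x : X} (hf : IsLocalDiffeomorphAt I J n f x)
    (hfg : g =ᶠ[𝓝 x] f) : IsLocalDiffeomorphAt I J n g x := by
  obtain ⟨Φ, hx, hΦ⟩ := hf
  obtain ⟨D, hD, hDo, hxD⟩ := eventually_nhds_iff.1 hfg
  let R := Φ.toOpenPartialHomeomorph.restrOpen D hDo
  exact ⟨{ R.toPartialEquiv with
    open_source := R.open_source
    open_target := R.open_target
    contMDiffOn_toFun := Φ.contMDiffOn_toFun.mono Set.inter_subset_left
    contMDiffOn_invFun := Φ.contMDiffOn_invFun.mono Set.inter_subset_left }, ⟨hx, hxD⟩,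
    fun y hy => (hD y hy.2).trans (hΦ hy.1)⟩

variable [I.Boundaryless] [J.Boundaryless] [IsManifold I n X] [IsManifold J n Y]

omit [CompleteSpace E] in
theorem isLocalDiffeomorphAt_extChartAt (x : X) :
    IsLocalDiffeomorphAt I 𝓘(ℝ, E) n (extChartAt I x) x :=
  ⟨{ extChartAt I x with
    open_source := isOpen_extChartAt_source x
    open_target := isOpen_extChartAt_target x
    contMDiffOn_toFun := extChartAt_source I x ▸ contMDiffOn_extChartAt
    contMDiffOn_invFun := contMDiffOn_extChartAt_symm x }, mem_extChartAt_source x, fun _ _ => rfl⟩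

omit [CompleteSpace E] in
theorem isLocalDiffeomorphAt_extChartAt_symm (x : X) :
    IsLocalDiffeomorphAt 𝓘(ℝ, E) I n (extChartAt I x).symm (extChartAt I x x) :=
  ⟨{ (extChartAt I x).symm with
    open_source := isOpen_extChartAt_target x
    open_target := isOpen_extChartAt_source x
    contMDiffOn_toFun := contMDiffOn_extChartAt_symm x
    contMDiffOn_invFun :=
      (contMDiffOn_extChartAt (x := x)).mono (extChartAt_source I x).subset },
    mem_extChartAt_target x, fun _ _ => rfl⟩

omit [CompleteSpace E] [J.Boundaryless] in
theorem eventually_contDiffAt_writtenInExtChartAt {f : X → Y} {x : X}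
    (hf : ∀ᶠ z in 𝓝 x, ContMDiffAt I J n f z) :
    ∀ᶠ u in 𝓝 (extChartAt I x x), ContDiffAt ℝ n (writtenInExtChartAt I J x f) u := by
  have hsource : ∀ᶠ z in 𝓝 x, f z ∈ (extChartAt J (f x)).source :=
    hf.self_of_nhds.continuousAt.eventually (extChartAt_source_mem_nhds (f x))
  have hsymm := (continuousAt_extChartAt_symm (I := I) x).tendsto
  rw [extChartAt_to_inv] at hsymm
  filter_upwards [hsymm.eventually (hf.and hsource), extChartAt_target_mem_nhds x]
    with u ⟨hfu, hu⟩ hue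
  have hchart : ContMDiffAt J 𝓘(ℝ, F) n (extChartAt J (f x)) (f ((extChartAt I x).symm u)) :=
    contMDiffAt_extChartAt' (extChartAt_source J (f x) ▸ hu)
  exact (hchart.comp u (hfu.comp u ((contMDiffOn_extChartAt_symm x).contMDiffAt
    (extChartAt_target_mem_nhds' hue)))).contDiffAt

theorem isLocalDiffeomorphAt_of_mfderiv_bijective [CompleteSpace F] {f : X → Y} {x : X}
    (hn : n ≠ 0) (hf : ∀ᶠ z in 𝓝 x, ContMDiffAt I J n f z)
    (hbij : Function.Bijective (mfderiv I J f x)) : IsLocalDiffeomorphAt I J n f x := by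
  let f' : E ≃L[ℝ] F := ContinuousLinearEquiv.ofBijective (mfderiv I J f x)
    (LinearMap.ker_eq_bot.2 hbij.1) (LinearMap.range_eq_top.2 hbij.2)
  have hderiv : HasFDerivAt (writtenInExtChartAt I J x f) (f' : E →L[ℝ] F) (extChartAt I x x) := by
    have hwithin : HasFDerivWithinAt (writtenInExtChartAt I J x f) (f' : E →L[ℝ] F) (Set.range I)
        (extChartAt I x x) := (hf.self_of_nhds.mdifferentiableAt hn).hasMFDerivAt.2
    rwa [I.range_eq_univ, hasFDerivWithinAt_univ] at hwithin
  have hcoord := isLocalDiffeomorphAt_of_hasFDerivAt_equiv hn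
    (eventually_contDiffAt_writtenInExtChartAt hf) hderiv
  have hsymm : IsLocalDiffeomorphAt 𝓘(ℝ, F) J n (extChartAt J (f x)).symm
      (writtenInExtChartAt I J x f (extChartAt I x x)) := by
    simpa only [writtenInExtChartAt, Function.comp_apply, extChartAt_to_inv] using
      isLocalDiffeomorphAt_extChartAt_symm (f x)
  refine isLocalDiffeomorphAt_congr (((isLocalDiffeomorphAt_extChartAt x).comp
    (hg := hcoord)).comp (hg := hsymm)) ?_
  filter_upwards [extChartAt_source_mem_nhds (I := I) x,
    hf.self_of_nhds.continuousAt (extChartAt_source_mem_nhds (I := J) (f x))] with z hz hfz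
  simp only [writtenInExtChartAt, Function.comp_apply, (extChartAt I x).left_inv hz,
    (extChartAt J (f x)).left_inv hfz]

end InverseFunction

/-! ### Parallel transport along the leaves -/

namespace Foliation

variable {m q : ℕ} {n : ℕ∞} {M N : Type*} [TopologicalSpace M]
  [ChartedSpace (EuclideanSpace ℝ (Fin m)) M] [IsManifold (𝓡 m) ∞ M] [TopologicalSpace N]
  [ChartedSpace (EuclideanSpace ℝ (Fin q)) N] [IsManifold (𝓡 q) ∞ N]
  {W : Foliation ((𝓡 m).prod (𝓡 q)) n m q (M × N)}

omit [IsManifold (𝓡 m) ∞ M] [IsManifold (𝓡 q) ∞ N] in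
theorem IsHorizontal.mfderiv_fst_prodMk_snd_chart_bijective (hW : W.IsHorizontal) (hn : 1 ≤ n) {φ}
    (hφ : φ ∈ W.atlas) {z : M × N} (hz : z ∈ φ.source) :
    Function.Bijective (mfderiv ((𝓡 m).prod (𝓡 q)) ((𝓡 m).prod 𝓘(ℝ, EuclideanSpace ℝ (Fin q)))
      (fun w => (w.1, (φ w).2)) z) := by
  let V := EuclideanSpace ℝ (Fin m) × EuclideanSpace ℝ (Fin q)
  let L : V →ₗ[ℝ] V := (mfderiv ((𝓡 m).prod (𝓡 q)) ((𝓡 m).prod 𝓘(ℝ, EuclideanSpace ℝ (Fin q)))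
      (fun w : M × N => (w.1, (φ w).2)) z).toLinearMap
  have hinj : Function.Injective L := by
    refine LinearMap.ker_eq_bot.1 (LinearMap.ker_eq_bot'.2 fun v hv => ?_)
    have hL := mfderiv_prodMk (mdifferentiableAt_fst (I := 𝓡 m) (I' := 𝓡 q))
      (W.mdifferentiableAt_snd_chart hn hφ hz)
    have hLv : ((_, _) : V) = 0 := (DFunLike.congr_fun hL v).symm.trans hv
    refine Submodule.disjoint_def.1 (hW z).disjoint v ?_ (congrArg Prod.fst hLv)
    rw [hW.tangent_eq_ker hn hφ hz]
    exact congrArg Prod.snd hLv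
  exact ⟨hinj, (LinearMap.injective_iff_surjective (f := L)).1 hinj⟩

theorem IsHorizontal.isLocalDiffeomorphAt_fst_prodMk_snd_chart (hW : W.IsHorizontal) (hn : 1 ≤ n)
    {φ} (hφ : φ ∈ W.atlas) {z : M × N} (hz : z ∈ φ.source) :
    IsLocalDiffeomorphAt ((𝓡 m).prod (𝓡 q)) ((𝓡 m).prod 𝓘(ℝ, EuclideanSpace ℝ (Fin q))) n
      (fun w => (w.1, (φ w).2)) z := by
  have hn_le : (n : WithTop ℕ∞) ≤ ∞ := by exact_mod_cast le_top
  have : IsManifold (𝓡 m) n M := .of_le hn_le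
  have : IsManifold (𝓡 q) n N := .of_le hn_le
  refine isLocalDiffeomorphAt_of_mfderiv_bijective (by simpa using (zero_lt_one.trans_le hn).ne')
    ?_ (hW.mfderiv_fst_prodMk_snd_chart_bijective hn hφ hz)
  filter_upwards [φ.open_source.mem_nhds hz] with w hw
  exact contMDiffAt_fst.prodMk (((contDiff_snd (𝕜 := ℝ)).contMDiff (n := n)).contMDiffAt.comp w
    ((W.contMDiffOn φ hφ).contMDiffAt (φ.open_source.mem_nhds hw)))

theorem IsHorizontal.exists_straightening (hW : W.IsHorizontal) (hn : 1 ≤ n) {φ}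
    (hφ : φ ∈ W.atlas) {z : M × N} (hz : z ∈ φ.source) :
    ∃ Φ : OpenPartialHomeomorph (M × N) (M × EuclideanSpace ℝ (Fin q)),
      z ∈ Φ.source ∧ Φ.source ⊆ φ.source ∧ (∀ w ∈ Φ.source, Φ w = (w.1, (φ w).2)) ∧
      ContMDiffOn ((𝓡 m).prod (𝓡 q)) ((𝓡 m).prod 𝓘(ℝ, EuclideanSpace ℝ (Fin q))) n Φ Φ.source ∧
      ContMDiffOn ((𝓡 m).prod 𝓘(ℝ, EuclideanSpace ℝ (Fin q))) ((𝓡 m).prod (𝓡 q)) n Φ.symm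
        Φ.target := by
  obtain ⟨Φ, hzΦ, hΦ⟩ := hW.isLocalDiffeomorphAt_fst_prodMk_snd_chart hn hφ hz
  exact ⟨Φ.toOpenPartialHomeomorph.restrOpen φ.source φ.open_source, ⟨hzΦ, hz⟩,
    Set.inter_subset_right, fun w hw => (hΦ hw.1).symm,
    Φ.contMDiffOn_toFun.mono Set.inter_subset_left,
    Φ.contMDiffOn_invFun.mono Set.inter_subset_left⟩

theorem IsHorizontal.eventually_eq (hW : W.IsHorizontal) (hn : 1 ≤ n) {Z : Type*}
    [TopologicalSpace Z] {γ γ' : Z → M × N} {t : Z} (hγ : W.LeafwiseAt γ t)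
    (hγ' : W.LeafwiseAt γ' t) (hfst : ∀ s, (γ s).1 = (γ' s).1) (ht : γ t = γ' t) :
    ∀ᶠ s in 𝓝 t, γ s = γ' s := by
  obtain ⟨φ, hφ, hz⟩ := W.covers (γ t)
  obtain ⟨Φ, hzΦ, -, hΦ, -⟩ := hW.exists_straightening hn hφ hz
  have hnear := Φ.open_source.mem_nhds hzΦ
  filter_upwards [hγ.1 hnear, hγ'.1 (ht ▸ hnear), hγ.2 φ hφ hz, hγ'.2 φ hφ (ht ▸ hz)]
    with s hs hs' hconst hconst'
  refine Φ.injOn hs hs' ?_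
  rw [hΦ _ hs, hΦ _ hs', hfst s, hconst, hconst', ht]

theorem IsHorizontal.eqOn (hW : W.IsHorizontal) (hn : 1 ≤ n) [T2Space N] {Z : Type*}
    [TopologicalSpace Z] {γ γ' : Z → M × N} {S : Set Z} (hS : IsPreconnected S)
    (hγ : ∀ t ∈ S, W.LeafwiseAt γ t) (hγ' : ∀ t ∈ S, W.LeafwiseAt γ' t)
    (hfst : ∀ s, (γ s).1 = (γ' s).1) {t : Z} (ht : t ∈ S) (h : γ t = γ' t) : Set.EqOn γ γ' S := by
  have hcover : S ⊆ {t | ∀ᶠ s in 𝓝 t, γ s = γ' s} ∪ {t | ∀ᶠ s in 𝓝 t, γ s ≠ γ' s} := by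
    intro s hs
    by_cases heq : γ s = γ' s
    · exact Or.inl (hW.eventually_eq hn (hγ s hs) (hγ' s hs) hfst heq)
    · have hne : (γ s).2 ≠ (γ' s).2 := fun hsnd => heq (Prod.ext (hfst s) hsnd)
      refine Or.inr ?_
      filter_upwards [((continuousAt_snd.comp (hγ s hs).1).ne_iff_eventually_ne
        (continuousAt_snd.comp (hγ' s hs).1)).1 hne] with r hr hr'
      exact hr (congrArg Prod.snd hr')
  intro s hs
  by_contra hne
  obtain ⟨r, -, hr, hr'⟩ := hS _ _ isOpen_setOfPred_eventually_nhds
    isOpen_setOfPred_eventually_nhds hcover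
    ⟨t, ht, hW.eventually_eq hn (hγ t ht) (hγ' t ht) hfst h⟩
    ⟨s, hs, (hcover hs).resolve_left fun h => hne h.self_of_nhds⟩
  exact hr'.self_of_nhds hr.self_of_nhds

section Straightening

variable {Φ : OpenPartialHomeomorph (M × N) (M × EuclideanSpace ℝ (Fin q))}

omit [IsManifold (𝓡 m) ∞ M] [IsManifold (𝓡 q) ∞ N] in
theorem leafwiseAt_straightening_symm {φ} (hφ : φ ∈ W.atlas) (hsource : Φ.source ⊆ φ.source)
    (hΦ : ∀ w ∈ Φ.source, Φ w = (w.1, (φ w).2)) {x : M} {b : EuclideanSpace ℝ (Fin q)}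
    (hx : (x, b) ∈ Φ.target) : W.LeafwiseAt (fun x => Φ.symm (x, b)) x := by
  have hpair : Continuous fun x : M => (x, b) := by fun_prop
  have hsnd : ∀ᶠ u in 𝓝 x, (φ (Φ.symm (u, b))).2 = b := by
    filter_upwards [hpair.continuousAt (Φ.open_target.mem_nhds hx)] with u hu
    have h := hΦ _ (Φ.map_target hu)
    rw [Φ.right_inv hu] at h
    exact (congrArg Prod.snd h).symm
  refine LeafwiseAt.of_chart (ContinuousAt.comp (g := Φ.symm) (Φ.continuousAt_symm hx)
    hpair.continuousAt) hφ (hsource (Φ.map_target hx)) ?_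
  filter_upwards [hsnd] with u hu
  rw [hu, hsnd.self_of_nhds]

omit [IsManifold (𝓡 m) ∞ M] [IsManifold (𝓡 q) ∞ N] in
theorem contMDiffAt_straightening_transport
    (hΦ : ContMDiffOn ((𝓡 m).prod (𝓡 q)) ((𝓡 m).prod 𝓘(ℝ, EuclideanSpace ℝ (Fin q))) n Φ Φ.source)
    (hΦ' : ContMDiffOn ((𝓡 m).prod 𝓘(ℝ, EuclideanSpace ℝ (Fin q))) ((𝓡 m).prod (𝓡 q)) n Φ.symm
      Φ.target) {x₁ x : M} {y : N} (hy : (x₁, y) ∈ Φ.source)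
    (hx : (x, (Φ (x₁, y)).2) ∈ Φ.target) :
    ContMDiffAt (𝓡 q) (𝓡 q) n (fun y => (Φ.symm (x, (Φ (x₁, y)).2)).2) y := by
  have hfst : ContMDiffAt (𝓡 q) 𝓘(ℝ, EuclideanSpace ℝ (Fin q)) n (fun y => (Φ (x₁, y)).2) y :=
    contMDiffAt_snd.comp y (ContMDiffAt.comp (g := Φ) y
      (hΦ.contMDiffAt (Φ.open_source.mem_nhds hy)) (contMDiffAt_const.prodMk contMDiffAt_id))
  exact contMDiffAt_snd.comp y (ContMDiffAt.comp (g := Φ.symm) y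
    (hΦ'.contMDiffAt (Φ.open_target.mem_nhds hx)) (contMDiffAt_const.prodMk hfst))

end Straightening

theorem IsHorizontal.exists_localTransport (hW : W.IsHorizontal) (hn : 1 ≤ n) (x₀ : M) (y₀ : N) :
    ∃ (U : Set M) (V : Set N) (S : M → M → N → N), IsOpen U ∧ x₀ ∈ U ∧ IsOpen V ∧ y₀ ∈ V ∧
      (∀ x ∈ U, ∀ y ∈ V, S x x y = y) ∧
      (∀ x₁ ∈ U, ∀ x ∈ U, ∀ y ∈ V, W.LeafwiseAt (fun x => (x, S x₁ x y)) x) ∧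
      ∀ x₁ ∈ U, ∀ x₂ ∈ U, ContMDiffOn (𝓡 q) (𝓡 q) n (S x₁ x₂) V := by
  obtain ⟨φ, hφ, hz⟩ := W.covers (x₀, y₀)
  obtain ⟨Φ, hzΦ, hsource, hΦ, hsmooth, hsmooth'⟩ := hW.exists_straightening hn hφ hz
  have hΦ_fst : ∀ w ∈ Φ.source, (Φ w).1 = w.1 := fun w hw => congrArg Prod.fst (hΦ w hw)
  have hΦ_pair : ∀ x y, (x, y) ∈ Φ.source → (x, (Φ (x, y)).2) = Φ (x, y) := fun x y hxy =>
    Prod.ext (hΦ_fst _ hxy).symm rfl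
  have hsymm_fst : ∀ w ∈ Φ.target, (Φ.symm w).1 = w.1 := fun w hw => by
    rw [← hΦ_fst _ (Φ.map_target hw), Φ.right_inv hw]
  have hnear : ∀ᶠ w in 𝓝 ((x₀, x₀), y₀), (w.1.1, w.2) ∈ Φ.source ∧
      (w.1.2, (Φ (w.1.1, w.2)).2) ∈ Φ.target := by
    have hfst : Continuous fun w : (M × M) × N => (w.1.1, w.2) := by fun_prop
    have hpair : ContinuousAt (fun w : (M × M) × N => (w.1.2, (Φ (w.1.1, w.2)).2))
        ((x₀, x₀), y₀) :=
      (continuous_snd.comp continuous_fst).continuousAt.prodMk (continuousAt_snd.comp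
        (ContinuousAt.comp (g := Φ) (Φ.continuousAt hzΦ) hfst.continuousAt))
    refine (hfst.continuousAt.eventually_mem (Φ.open_source.mem_nhds hzΦ)).and
      (hpair.eventually_mem (Φ.open_target.mem_nhds ?_))
    exact (hΦ_pair _ _ hzΦ).symm ▸ Φ.map_source hzΦ
  obtain ⟨O, V, hO, hO₀, hV, hV₀, hOV⟩ := mem_nhds_prod_iff'.1 hnear
  obtain ⟨U, hU, hU₀, hUO⟩ := exists_nhds_square (hO.mem_nhds hO₀)
  have hUV : ∀ x₁ ∈ U, ∀ x ∈ U, ∀ y ∈ V, (x₁, y) ∈ Φ.source ∧ (x, (Φ (x₁, y)).2) ∈ Φ.target :=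
    fun x₁ hx₁ x hx y hy => hOV (Set.mk_mem_prod (hUO (Set.mk_mem_prod hx₁ hx)) hy)
  refine ⟨U, V, fun x₁ x y => (Φ.symm (x, (Φ (x₁, y)).2)).2, hU, hU₀, hV, hV₀,
    fun x hx y hy => ?_, fun x₁ hx₁ x hx y hy => ?_, fun x₁ hx₁ x hx y hy =>
      (contMDiffAt_straightening_transport hsmooth hsmooth' (hUV x₁ hx₁ x hx y hy).1
        (hUV x₁ hx₁ x hx y hy).2).contMDiffWithinAt⟩
  · have hxy := (hUV x hx x hx y hy).1
    simp only [hΦ_pair x y hxy, Φ.left_inv hxy]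
  · refine (leafwiseAt_straightening_symm hφ hsource hΦ (hUV x₁ hx₁ x hx y hy).2).congr ?_
    filter_upwards [hU.mem_nhds hx] with u hu
    exact Prod.ext (hsymm_fst _ (hUV x₁ hx₁ u hu y hy).2).symm rfl

end Foliation

/-! ### Flat transports over simply connected spaces -/

/-- A flat transport on the trivial family over `B` with fiber `F`: over a neighborhood of each
point `i`, a family of identifications `transport i x₁ x₂` of the fiber over `x₁` with the fiber
over `x₂`, compatible with composition. The families of different points agree only locally, as do
the transports along the leaves of a foliation. -/
structure FlatTransport (B F : Type*) [TopologicalSpace B] where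
  /-- the neighborhood of `i` over which the transport is defined -/
  baseSet : B → Set B
  isOpen_baseSet : ∀ i, IsOpen (baseSet i)
  mem_baseSet : ∀ i, i ∈ baseSet i
  /-- the transport from the fiber over `x₁` to the fiber over `x₂` -/
  transport : B → B → B → F → F
  transport_self : ∀ i, ∀ x ∈ baseSet i, ∀ v, transport i x x v = v
  transport_transport : ∀ i, ∀ x₁ ∈ baseSet i, ∀ x₂ ∈ baseSet i, ∀ x₃ ∈ baseSet i, ∀ v,
    transport i x₂ x₃ (transport i x₁ x₂ v) = transport i x₁ x₃ v
  eventually_eq : ∀ i j, ∀ x₁ ∈ baseSet i ∩ baseSet j, ∀ v,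
    ∀ᶠ x in 𝓝 x₁, transport i x₁ x v = transport j x₁ x v

namespace FlatTransport

variable {B F : Type*} [TopologicalSpace B]

theorem eventually_transport_transport_eq (T : FlatTransport B F) {i j x₁ : B}
    (hx₁ : x₁ ∈ T.baseSet i ∩ T.baseSet j) (v : F) :
    ∀ᶠ x in 𝓝 x₁, T.transport j x j (T.transport i i x v) =
      T.transport j x₁ j (T.transport i i x₁ v) := by
  filter_upwards [T.eventually_eq i j x₁ hx₁ (T.transport i i x₁ v),
    (T.isOpen_baseSet i).mem_nhds hx₁.1, (T.isOpen_baseSet j).mem_nhds hx₁.2] with x hx hxi hxj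
  rw [T.transport_transport i i (T.mem_baseSet i) x₁ hx₁.1 x hxi] at hx
  rw [hx, T.transport_transport j x₁ hx₁.2 x hxj j (T.mem_baseSet j)]

/-- The bundle with discrete fiber `F` whose flat sections over the neighborhood of `i` are the
sections `x ↦ transport i i x v`. -/
def fiberBundleCore (T : FlatTransport B F) [TopologicalSpace F] [DiscreteTopology F] :
    FiberBundleCore B B F where
  baseSet := T.baseSet
  isOpen_baseSet := T.isOpen_baseSet
  indexAt := id
  mem_baseSet_at := T.mem_baseSet
  coordChange i j x v := T.transport j x j (T.transport i i x v)
  coordChange_self i x hx v := by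
    rw [T.transport_transport i i (T.mem_baseSet i) x hx i (T.mem_baseSet i),
      T.transport_self i i (T.mem_baseSet i)]
  continuousOn_coordChange := by
    rintro i j ⟨x₁, v⟩ ⟨hx₁, -⟩
    have hconst : ∀ᶠ z : B × F in 𝓝 (x₁, v), T.transport j z.1 j (T.transport i i z.1 z.2) =
        T.transport j x₁ j (T.transport i i x₁ v) := by
      rw [nhds_prod_eq, nhds_discrete F]
      filter_upwards [(T.eventually_transport_transport_eq hx₁ v).prod_mk
        (Filter.eventually_pure.2 (rfl : v = v))] with z hz
      rw [← hz.2]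
      exact hz.1
    exact (continuousAt_const.congr (hconst.mono fun _ h => h.symm)).continuousWithinAt
  coordChange_comp := by
    rintro i j k x ⟨⟨-, hj⟩, -⟩ v
    rw [T.transport_transport j x hj j (T.mem_baseSet j) x hj, T.transport_self j x hj]

variable {A : Type*} [TopologicalSpace A] [SimplyConnectedSpace A] [LocallyPathConnectedSpace A]

theorem exists_section (T : FlatTransport B F) (f : C(A, B)) (a₀ : A) (v₀ : F) :
    ∃ ℓ : A → F, ℓ a₀ = v₀ ∧ ∀ i C, IsPreconnected C → Set.MapsTo f C (T.baseSet i) →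
      ∀ a ∈ C, ∀ a' ∈ C, ℓ a' = T.transport i (f a) (f a') (ℓ a) := by
  let _ : TopologicalSpace F := ⊥
  have : DiscreteTopology F := ⟨rfl⟩
  let Z := T.fiberBundleCore
  have hcov : IsCoveringMap (Bundle.TotalSpace.proj : Bundle.TotalSpace F Z.Fiber → B) :=
    FiberBundle.isCoveringMap
  obtain ⟨G, ⟨hG₀, hGf⟩, -⟩ := hcov.existsUnique_continuousMap_lifts f a₀ ⟨f a₀, v₀⟩ rfl
  have hproj : ∀ a, (G a).proj = f a := fun a => congrFun hGf a
  let snd : Bundle.TotalSpace F Z.Fiber → F := fun z => z.2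
  refine ⟨fun a => snd (G a), congrArg snd hG₀, fun i C hC hCi a ha a' ha' => ?_⟩
  have hcoord : ∀ u, (Z.localTriv i (G u)).2 = T.transport i (f u) i (snd (G u)) := fun u => by
    change T.transport i (G u).proj i
      (T.transport (G u).proj (G u).proj (G u).proj (snd (G u))) = _
    rw [T.transport_self _ _ (T.mem_baseSet _), hproj]
  have hconst : (Z.localTriv i (G a')).2 = (Z.localTriv i (G a)).2 := by
    refine hC.constant (f := fun u => (Z.localTriv i (G u)).2) (fun u hu => ?_) ha' ha
    refine (continuousAt_snd.comp (ContinuousAt.comp (g := Z.localTriv i) ?_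
      G.continuous.continuousAt)).continuousWithinAt
    refine (Z.localTriv i).continuousAt ?_
    rw [Z.mem_localTriv_source, hproj]
    exact hCi hu
  rw [hcoord, hcoord] at hconst
  have h := congrArg (T.transport i i (f a')) hconst
  rwa [T.transport_transport i _ (hCi ha') _ (T.mem_baseSet i) _ (hCi ha'),
    T.transport_self i _ (hCi ha'),
    T.transport_transport i _ (hCi ha) _ (T.mem_baseSet i) _ (hCi ha')] at h

theorem exists_transport (T : FlatTransport B F) (f : C(A, B)) :
    ∃ Θ : A → A → F → F, (∀ a v, Θ a a v = v) ∧
      ∀ a, ∃ C ∈ 𝓝 a, Set.MapsTo f C (T.baseSet (f a)) ∧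
        ∀ a₁, ∀ u ∈ C, ∀ w ∈ C, Θ a₁ w = T.transport (f a) (f u) (f w) ∘ Θ a₁ u := by
  choose ℓ hℓ hflat using T.exists_section f
  refine ⟨fun a₁ a v => ℓ a₁ v a, hℓ, fun a => ?_⟩
  obtain ⟨C, ⟨hC, hCconn⟩, hCsub⟩ := (LocallyPathConnectedSpace.path_connected_basis a).mem_iff.1
    (f.continuous.continuousAt ((T.isOpen_baseSet (f a)).mem_nhds (T.mem_baseSet (f a))))
  exact ⟨C, hC, hCsub, fun a₁ u hu w hw => funext fun v =>
    hflat a₁ v (f a) C hCconn.isConnected.isPreconnected hCsub u hu w hw⟩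

end FlatTransport

/-! ### Parallel transport over a simply connected space -/

namespace Foliation

variable {m q : ℕ} {n : ℕ∞} {M N : Type*} [TopologicalSpace M]
  [ChartedSpace (EuclideanSpace ℝ (Fin m)) M] [IsManifold (𝓡 m) ∞ M] [TopologicalSpace N]
  [ChartedSpace (EuclideanSpace ℝ (Fin q)) N] [IsManifold (𝓡 q) ∞ N]
  {W : Foliation ((𝓡 m).prod (𝓡 q)) n m q (M × N)} [T2Space N] [CompactSpace N]

theorem IsHorizontal.exists_fiber_transport (hW : W.IsHorizontal) (hn : 1 ≤ n) (x₀ : M) :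
    ∃ (U : Set M) (T : M → M → N → N), IsOpen U ∧ x₀ ∈ U ∧ IsPreconnected U ∧
      (∀ x ∈ U, ∀ y, T x x y = y) ∧
      (∀ x₁ ∈ U, ∀ x ∈ U, ∀ y, W.LeafwiseAt (fun x => (x, T x₁ x y)) x) ∧
      ∀ x₁ ∈ U, ∀ x₂ ∈ U, ContMDiff (𝓡 q) (𝓡 q) n (T x₁ x₂) := by
  have := ChartedSpace.locallyConnectedSpace (EuclideanSpace ℝ (Fin m)) M
  choose U V S hU hU₀ hV hV₀ hS hleaf hsmooth using hW.exists_localTransport hn x₀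
  obtain ⟨F, hF⟩ := CompactSpace.elim_nhds_subcover V fun y => (hV y).mem_nhds (hV₀ y)
  have hcover : ∀ y, ∃ i ∈ F, y ∈ V i := fun y => by
    simpa only [Set.mem_iUnion, exists_prop] using hF.ge (Set.mem_univ y)
  choose i hiF hi using hcover
  let C : Set M := connectedComponentIn (⋂ j ∈ F, U j) x₀
  have hCU : ∀ x ∈ C, ∀ j ∈ F, x ∈ U j := fun x hx =>
    Set.mem_iInter₂.1 (connectedComponentIn_subset _ _ hx)
  have hS_eq : ∀ j ∈ F, ∀ k ∈ F, ∀ y ∈ V j ∩ V k, ∀ x₁ ∈ C, ∀ x₂ ∈ C, S j x₁ x₂ y = S k x₁ x₂ y :=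
    fun j hj k hk y hy x₁ hx₁ x₂ hx₂ => congrArg Prod.snd
      (hW.eqOn hn (γ := fun x => (x, S j x₁ x y)) (γ' := fun x => (x, S k x₁ x y))
        isPreconnected_connectedComponentIn
        (fun x hx => hleaf j x₁ (hCU x₁ hx₁ j hj) x (hCU x hx j hj) y hy.1)
        (fun x hx => hleaf k x₁ (hCU x₁ hx₁ k hk) x (hCU x hx k hk) y hy.2) (fun _ => rfl) hx₁
        (by rw [hS j x₁ (hCU x₁ hx₁ j hj) y hy.1, hS k x₁ (hCU x₁ hx₁ k hk) y hy.2]) hx₂)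
  refine ⟨C, fun x₁ x₂ y => S (i y) x₁ x₂ y,
    (isOpen_biInter_finset fun j _ => hU j).connectedComponentIn,
    mem_connectedComponentIn (Set.mem_iInter₂.2 fun j _ => hU₀ j),
    isPreconnected_connectedComponentIn, fun x hx y => hS _ x (hCU x hx _ (hiF y)) y (hi y),
    fun x₁ hx₁ x hx y => hleaf _ x₁ (hCU x₁ hx₁ _ (hiF y)) x (hCU x hx _ (hiF y)) y (hi y),
    fun x₁ hx₁ x₂ hx₂ y => ?_⟩
  have hVy := (hV (i y)).mem_nhds (hi y)
  refine ((hsmooth (i y) x₁ (hCU x₁ hx₁ _ (hiF y)) x₂ (hCU x₂ hx₂ _ (hiF y))).contMDiffAt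
    hVy).congr_of_eventuallyEq ?_
  filter_upwards [hVy] with y' hy'
  exact hS_eq _ (hiF y') _ (hiF y) y' ⟨hi y', hy'⟩ x₁ hx₁ x₂ hx₂

theorem IsHorizontal.exists_flatTransport (hW : W.IsHorizontal) (hn : 1 ≤ n) :
    ∃ T : FlatTransport M N,
      (∀ i, ∀ x₁ ∈ T.baseSet i, ∀ x ∈ T.baseSet i, ∀ y,
        W.LeafwiseAt (fun x => (x, T.transport i x₁ x y)) x) ∧
      ∀ i, ∀ x₁ ∈ T.baseSet i, ∀ x₂ ∈ T.baseSet i,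
        ContMDiff (𝓡 q) (𝓡 q) n (T.transport i x₁ x₂) := by
  choose U T hU hU₀ hconn hT hleaf hsmooth using hW.exists_fiber_transport hn
  refine ⟨{
    baseSet := U
    isOpen_baseSet := hU
    mem_baseSet := hU₀
    transport := T
    transport_self := hT
    transport_transport := fun i x₁ h₁ x₂ h₂ x₃ h₃ y => congrArg Prod.snd
      (hW.eqOn hn (hconn i) (γ := fun x => (x, T i x₂ x (T i x₁ x₂ y)))
        (γ' := fun x => (x, T i x₁ x y)) (fun x hx => hleaf i x₂ h₂ x hx _)
        (fun x hx => hleaf i x₁ h₁ x hx _) (fun _ => rfl) h₂ (by rw [hT i x₂ h₂]) h₃)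
    eventually_eq := ?_ }, hleaf, hsmooth⟩
  rintro i j x₁ ⟨hi, hj⟩ y
  filter_upwards [hW.eventually_eq hn (hleaf i x₁ hi x₁ hi y) (hleaf j x₁ hj x₁ hj y)
    (fun _ => rfl) (by rw [hT i x₁ hi, hT j x₁ hj])] with x hx
  exact congrArg Prod.snd hx

theorem IsHorizontal.exists_global_transport (hW : W.IsHorizontal) (hn : 1 ≤ n) {M' : Type*}
    [TopologicalSpace M'] [SimplyConnectedSpace M'] [LocallyPathConnectedSpace M'] (p : C(M', M)) :
    ∃ Θ : M' → M' → N → N, (∀ x y, Θ x x y = y) ∧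
      (∀ x₁ y x, W.LeafwiseAt (fun x => (p x, Θ x₁ x y)) x) ∧
      ∀ x₁ x₂, ContMDiff (𝓡 q) (𝓡 q) n (Θ x₁ x₂) := by
  obtain ⟨T, hleaf, hsmooth⟩ := hW.exists_flatTransport hn
  obtain ⟨Θ, hΘ, hΘT⟩ := T.exists_transport p
  refine ⟨Θ, hΘ, fun x₁ y x => ?_, fun x₁ x₂ => ?_⟩
  · obtain ⟨C, hC, -, hflat⟩ := hΘT x
    refine ((hleaf (p x) (p x) (T.mem_baseSet _) (p x) (T.mem_baseSet _) (Θ x₁ x y)).comp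
      p.continuous.continuousAt).congr ?_
    filter_upwards [hC] with w hw
    rw [hflat x₁ x (mem_of_mem_nhds hC) w hw]
    rfl
  · have hlocal : IsLocallyConstant fun x => ContMDiff (𝓡 q) (𝓡 q) n (Θ x₁ x) := by
      refine (IsLocallyConstant.iff_eventually_eq _).2 fun x => ?_
      obtain ⟨C, hC, hCT, hflat⟩ := hΘT x
      have hcomp : ∀ u ∈ C, ∀ w ∈ C, ContMDiff (𝓡 q) (𝓡 q) n (Θ x₁ u) →
          ContMDiff (𝓡 q) (𝓡 q) n (Θ x₁ w) := fun u hu w hw hu_smooth => by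
        rw [hflat x₁ u hu w hw]
        exact (hsmooth _ _ (hCT hu) _ (hCT hw)).comp hu_smooth
      have hx := mem_of_mem_nhds hC
      filter_upwards [hC] with w hw
      exact propext ⟨hcomp w hw x hx, hcomp x hx w hw⟩
    refine (hlocal.apply_eq_of_preconnectedSpace x₁ x₂).mp ?_
    rw [funext (hΘ x₁)]
    exact contMDiff_id

end Foliation

/-! ### Deck transformations -/

theorem locallyPathConnectedSpace_of_isLocalHomeomorph {E X : Type*} [TopologicalSpace E]
    [TopologicalSpace X] [LocallyPathConnectedSpace X] {p : E → X} (hp : IsLocalHomeomorph p) :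
    LocallyPathConnectedSpace E := by
  choose φ hφ _ using hp
  let _ : ChartedSpace X E :=
    { atlas := Set.range φ
      chartAt := φ
      mem_chart_source := hφ
      chart_mem_atlas := fun e => ⟨e, rfl⟩ }
  exact ChartedSpace.locallyPathConnectedSpace X E

section DeckTransformation

variable {E X : Type*} [TopologicalSpace E] [TopologicalSpace X] {p : E → X}

theorem exists_deckTransformation [SimplyConnectedSpace E] [LocallyPathConnectedSpace E]
    (hp : IsCoveringMap p) {x e : E} (he : p e = p x) : ∃ D : E ≃ₜ E, p ∘ D = p ∧ D x = e := by
  obtain ⟨F, ⟨hF, hpF⟩, -⟩ := hp.existsUnique_continuousMap_lifts ⟨p, hp.continuous⟩ x e he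
  obtain ⟨G, ⟨hG, hpG⟩, -⟩ := hp.existsUnique_continuousMap_lifts ⟨p, hp.continuous⟩ e x he.symm
  have hpF' (u) : p (F u) = p u := congrFun hpF u
  have hpG' (u) : p (G u) = p u := congrFun hpG u
  have left_inv : G ∘ F = id := hp.eq_of_comp_eq (G.continuous.comp F.continuous) continuous_id
    (funext fun u => (hpG' _).trans (hpF' u)) x ((congrArg G hF).trans hG)
  have right_inv : F ∘ G = id := hp.eq_of_comp_eq (F.continuous.comp G.continuous) continuous_id
    (funext fun u => (hpF' _).trans (hpG' u)) e ((congrArg F hG).trans hF)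
  exact ⟨⟨⟨F, G, congrFun left_inv, congrFun right_inv⟩, F.continuous, G.continuous⟩, hpF, hF⟩

theorem monodromy_mul_eq_deckTransformation (hp : IsCoveringMap p) {x : E}
    {σ τ : FundamentalGroup X (p x)} {D D' : E ≃ₜ E} (hD : IsDeckTransformation hp x σ D)
    (hD' : IsDeckTransformation hp x τ D') : (hp.monodromy (σ * τ) ⟨x, rfl⟩ : E) = D' (D x) := by
  have hmul : hp.monodromy (σ * τ) ⟨x, rfl⟩ = hp.monodromy σ (hp.monodromy τ ⟨x, rfl⟩) :=
    DFunLike.congr_fun (map_mul (hp.monodromyPerm (p x)) σ τ) ⟨x, rfl⟩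
  have hτ : hp.monodromy τ ⟨x, rfl⟩ = ⟨D' x, congrFun hD'.1 x⟩ := Subtype.ext hD'.2.symm
  have hσ : Path.Homotopic.Quotient.map σ (ContinuousMap.id X) = σ := by
    obtain ⟨σ⟩ := σ
    rfl
  have hmap := monodromy_map_eq hp hp (F' := ⟨D', D'.continuous⟩) (F := ContinuousMap.id X)
    (congrFun hD'.1) σ ⟨x, rfl⟩
  rw [hmul, hτ, hD.2]
  exact (congrArg (fun σ => (hp.monodromy σ ⟨D' x, congrFun hD'.1 x⟩ : E)) hσ.symm).trans hmap

end DeckTransformation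

/-! ### The holonomy homomorphism -/

namespace Foliation

/-- Parallel transport along the lift to `M' × N` of a foliation of `M × N`, where `p : M' → M`:
the leaf through `(x₁, y)` meets the fiber over `x₂` in `(x₂, Θ x₁ x₂ y)`. -/
structure LeafTransport {m q : ℕ} {n : ℕ∞} {M N M' : Type*} [TopologicalSpace M]
    [ChartedSpace (EuclideanSpace ℝ (Fin m)) M] [TopologicalSpace N]
    [ChartedSpace (EuclideanSpace ℝ (Fin q)) N] [TopologicalSpace M']
    (W : Foliation ((𝓡 m).prod (𝓡 q)) n m q (M × N)) (p : M' → M) where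
  /-- the transport from the fiber over `x₁` to the fiber over `x₂` -/
  toDiff : M' → M' → Diff (𝓡 q) n N
  self : ∀ x, toDiff x x = 1
  leafwiseAt : ∀ x₁ y x, W.LeafwiseAt (fun x => (p x, (toDiff x₁ x).1 y)) x

variable {m q : ℕ} {n : ℕ∞} {M N M' : Type*} [TopologicalSpace M]
  [ChartedSpace (EuclideanSpace ℝ (Fin m)) M] [IsManifold (𝓡 m) ∞ M] [TopologicalSpace N]
  [ChartedSpace (EuclideanSpace ℝ (Fin q)) N] [IsManifold (𝓡 q) ∞ N] [T2Space N]
  [TopologicalSpace M'] {W : Foliation ((𝓡 m).prod (𝓡 q)) n m q (M × N)} {p : M' → M}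

theorem IsHorizontal.nonempty_leafTransport [CompactSpace N] [SimplyConnectedSpace M']
    [LocallyPathConnectedSpace M'] (hW : W.IsHorizontal) (hn : 1 ≤ n) (hp : Continuous p) :
    Nonempty (W.LeafTransport p) := by
  obtain ⟨Θ, hΘ, hleaf, hsmooth⟩ := hW.exists_global_transport hn ⟨p, hp⟩
  have hinv (x₁ x₂ y) : Θ x₂ x₁ (Θ x₁ x₂ y) = y := by
    have heq := hW.eqOn hn isPreconnected_univ (γ := fun x => (p x, Θ x₂ x (Θ x₁ x₂ y)))
      (γ' := fun x => (p x, Θ x₁ x y)) (fun x _ => hleaf x₂ _ x) (fun x _ => hleaf x₁ y x)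
      (fun _ => rfl) (Set.mem_univ x₂) (by rw [hΘ])
    exact (congrArg Prod.snd (heq (Set.mem_univ x₁))).trans (hΘ x₁ y)
  exact ⟨{
    toDiff := fun x₁ x₂ =>
      ⟨⟨Θ x₁ x₂, Θ x₂ x₁, hinv x₁ x₂, hinv x₂ x₁⟩, hsmooth x₁ x₂, hsmooth x₂ x₁⟩
    self := fun x => Subtype.ext (Equiv.ext (hΘ x))
    leafwiseAt := hleaf }⟩

namespace LeafTransport

theorem eq_toDiff_apply (Θ : W.LeafTransport p) (hW : W.IsHorizontal) (hn : 1 ≤ n) {Z : Type*}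
    [TopologicalSpace Z] [PreconnectedSpace Z] {f : Z → M'} (hf : Continuous f) {ℓ : Z → N}
    (hℓ : ∀ z, W.LeafwiseAt (fun z => (p (f z), ℓ z)) z) (z₁ z : Z) :
    ℓ z = (Θ.toDiff (f z₁) (f z)).1 (ℓ z₁) := by
  have heq := hW.eqOn hn isPreconnected_univ (γ := fun z => (p (f z), ℓ z))
    (γ' := fun z => (p (f z), (Θ.toDiff (f z₁) (f z)).1 (ℓ z₁))) (fun z _ => hℓ z)
    (fun z _ => (Θ.leafwiseAt (f z₁) (ℓ z₁) (f z)).comp hf.continuousAt) (fun _ => rfl)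
    (Set.mem_univ z₁) (by rw [Θ.self]; rfl)
  exact congrArg Prod.snd (heq (Set.mem_univ z))

theorem toDiff_mul [PreconnectedSpace M'] (Θ : W.LeafTransport p) (hW : W.IsHorizontal)
    (hn : 1 ≤ n) (x₁ x₂ x₃ : M') : Θ.toDiff x₂ x₃ * Θ.toDiff x₁ x₂ = Θ.toDiff x₁ x₃ :=
  Subtype.ext (Equiv.ext fun y =>
    (Θ.eq_toDiff_apply hW hn continuous_id (Θ.leafwiseAt x₁ y) x₂ x₃).symm)

theorem toDiff_deckTransformation [PreconnectedSpace M'] (Θ : W.LeafTransport p)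
    (hW : W.IsHorizontal) (hn : 1 ≤ n) {D : M' → M'} (hD : Continuous D) (hpD : p ∘ D = p)
    (x₁ x₂ : M') : Θ.toDiff (D x₁) (D x₂) = Θ.toDiff x₁ x₂ := by
  refine Subtype.ext (Equiv.ext fun y => ?_)
  have hleaf (x) : W.LeafwiseAt (fun x => (p (D x), (Θ.toDiff x₁ x).1 y)) x := by
    simpa only [show ∀ x, p (D x) = p x from congrFun hpD] using Θ.leafwiseAt x₁ y x
  simpa only [Θ.self] using! (Θ.eq_toDiff_apply hW hn hD hleaf x₁ x₂).symm

theorem liftedLeaf_inter [PathConnectedSpace M'] (Θ : W.LeafTransport p) (hW : W.IsHorizontal)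
    (hn : 1 ≤ n) (hp : Continuous p) (x' x : M') (y : N) :
    W.liftedLeaf p (x', y) ∩ {z | z.1 = x} = {(x, (Θ.toDiff x' x).1 y)} := by
  have hcont : Continuous fun x => (Θ.toDiff x' x).1 y :=
    continuous_iff_continuousAt.2 fun x => continuousAt_snd.comp (Θ.leafwiseAt x' y x).1
  ext ⟨z₁, z₂⟩
  constructor
  · rintro ⟨⟨γ, hγ⟩, rfl⟩
    have hpγ : Continuous fun t => (p (γ t).1, (γ t).2) := by fun_prop
    have heq := Θ.eq_toDiff_apply hW hn (f := fun t => (γ t).1) (by fun_prop)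
      (fun t => ⟨hpγ.continuousAt, fun φ hφ ht => hγ φ hφ t ht⟩) 0 1
    simp only [Path.source, Path.target] at heq
    exact Prod.ext rfl heq
  · rintro ⟨⟩
    let δ := PathConnectedSpace.somePath x' x
    refine ⟨⟨(δ.prod (δ.map hcont)).cast (by rw [Θ.self]; rfl) rfl, fun φ hφ t ht => ?_⟩, rfl⟩
    exact ((Θ.leafwiseAt x' y (δ t)).comp δ.continuous.continuousAt).2 φ hφ ht

section Holonomy

variable [SimplyConnectedSpace M'] [LocallyPathConnectedSpace M']

/-- The holonomy homomorphism of a horizontal foliation: `σ` is sent to the transport from the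
fiber over `x'` to the fiber over the endpoint of the lift of `σ` that starts at `x'`. -/
noncomputable def holonomy (Θ : W.LeafTransport p) (hW : W.IsHorizontal) (hn : 1 ≤ n)
    (hp : IsCoveringMap p) (x' : M') : FundamentalGroup M (p x') →* Diff (𝓡 q) n N :=
  MonoidHom.mk' (fun σ => Θ.toDiff x' (hp.monodromy σ ⟨x', rfl⟩)) fun σ τ => by
    obtain ⟨D, hD⟩ := exists_deckTransformation hp (hp.monodromy σ ⟨x', rfl⟩).2
    obtain ⟨D', hD'⟩ := exists_deckTransformation hp (hp.monodromy τ ⟨x', rfl⟩).2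
    rw [monodromy_mul_eq_deckTransformation hp hD hD', ← hD.2, ← hD'.2,
      ← Θ.toDiff_mul hW hn x' (D' x'), Θ.toDiff_deckTransformation hW hn D'.continuous hD'.1]

theorem holonomy_eq_inv_mul (Θ : W.LeafTransport p) (hW : W.IsHorizontal) (hn : 1 ≤ n)
    (hp : IsCoveringMap p) {x' : M'} {σ : FundamentalGroup M (p x')} {D : M' ≃ₜ M'}
    (hD : IsDeckTransformation hp x' σ D) (x : M') :
    Θ.holonomy hW hn hp x' σ = (Θ.toDiff x' x)⁻¹ * Θ.toDiff x' (D x) := by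
  change Θ.toDiff x' (hp.monodromy σ ⟨x', rfl⟩) = _
  rw [← hD.2, eq_inv_mul_iff_mul_eq, ← Θ.toDiff_deckTransformation hW hn D.continuous hD.1 x' x,
    Θ.toDiff_mul hW hn]

theorem holonomy_mapOfEq (Θ : W.LeafTransport p) (hW : W.IsHorizontal) (hn : 1 ≤ n)
    (hp : IsCoveringMap p) {x' : M'} {F : C(M, M)} (hF : F (p x') = p x') {G : M × N → M × N}
    (hG : ContMDiff ((𝓡 m).prod (𝓡 q)) ((𝓡 m).prod (𝓡 q)) 1 G) (hinv : W.IsInvariant G)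
    (hGF : ∀ z, (G z).1 = F z.1) (hGx : ∀ y, G (p x', y) = (p x', y))
    (σ : FundamentalGroup M (p x')) :
    Θ.holonomy hW hn hp x' (FundamentalGroup.mapOfEq F hF σ) = Θ.holonomy hW hn hp x' σ := by
  obtain ⟨F', ⟨hF', hpF'⟩, -⟩ :=
    hp.existsUnique_continuousMap_lifts (F.comp ⟨p, hp.continuous⟩) x' x' hF.symm
  have hmonodromy := monodromy_mapOfEq_eq hp hp (congrFun hpF') hF σ ⟨x', rfl⟩ ⟨x', rfl⟩ hF'
  refine Subtype.ext (Equiv.ext fun y => ?_)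
  have hleaf (x) : W.LeafwiseAt (fun x => (p (F' x), (G (p x, (Θ.toDiff x' x).1 y)).2)) x := by
    refine (hW.leafwiseAt_comp hn hG hinv (Θ.leafwiseAt x' y x)).congr
      (Filter.Eventually.of_forall fun u => Prod.ext ?_ rfl)
    exact (congrFun hpF' u).trans (hGF (p u, _)).symm
  have htransport (x) :
      (Θ.toDiff x' (F' x)).1 y = (G (p x, (Θ.toDiff x' x).1 y)).2 := by
    simpa only [hF', Θ.self, hGx] using!
      (Θ.eq_toDiff_apply hW hn F'.continuous hleaf x' x).symm
  change (Θ.toDiff x' (hp.monodromy _ _)).1 y = (Θ.toDiff x' (hp.monodromy σ _)).1 y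
  rw [hmonodromy, htransport, show p (hp.monodromy σ ⟨x', rfl⟩) = p x' from
    (hp.monodromy σ ⟨x', rfl⟩).2, hGx]

end Holonomy

end LeafTransport

end Foliation

theorem contMDiff_extension {k m q : ℕ} {M N : Type*}
    [TopologicalSpace M] [ChartedSpace (EuclideanSpace ℝ (Fin m)) M]
    [TopologicalSpace N] [ChartedSpace (EuclideanSpace ℝ (Fin q)) N]
    {α : IntLattice k →* Diff (𝓡 m) ∞ M} {β : IntLattice k → M → Diff (𝓡 q) 1 N}
    (hβ : IsCocycle α β) (a : IntLattice k) :
    ContMDiff ((𝓡 m).prod (𝓡 q)) ((𝓡 m).prod (𝓡 q)) 1 (extension α β a) :=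
  (((α a).2.1.of_le (by simp)).comp contMDiff_fst).prodMk (hβ.contMDiff a)

theorem mainTheorem7_general {k m q : ℕ}
    {M : Type*} [TopologicalSpace M] [ChartedSpace (EuclideanSpace ℝ (Fin m)) M]
    [IsManifold (𝓡 m) ∞ M]
    {N : Type*} [TopologicalSpace N] [ChartedSpace (EuclideanSpace ℝ (Fin q)) N]
    [IsManifold (𝓡 q) ∞ N] [T2Space N] [CompactSpace N]
    (α : IntLattice k →* Diff (𝓡 m) ∞ M)
    (hα : ∃ a, IsAffineAutomorphism m (α a).1 ∧ IsAnosov (m := m) (α a).1)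
    {M' : Type*} [TopologicalSpace M'] [SimplyConnectedSpace M']
    (p : M' → M) (hp : IsCoveringMap p) (x' : M') (hx : ∀ a, (α a).1 (p x') = p x')
    (β : IntLattice k → M → Diff (𝓡 q) 1 N) (hβ : IsCocycle α β) (hβx : ∀ a, β a (p x') = 1)
    (n : ℕ∞) (hn : 1 ≤ n) (W : Foliation ((𝓡 m).prod (𝓡 q)) n m q (M × N))
    (hW : W.IsHorizontal) (hW_inv : ∀ a, W.IsInvariant (extension α β a)) :
    ∃ (h : M' → Diff (𝓡 q) n N)
      (D : FundamentalGroup M (p x') → (M' ≃ₜ M'))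
      (H : FundamentalGroup M (p x') →* Diff (𝓡 q) n N),
      (∀ x y, W.liftedLeaf p (x', y) ∩ {z | z.1 = x} = {(x, (h x).1 y)}) ∧
      (∀ σ, IsDeckTransformation hp x' σ (D σ)) ∧
      (∀ σ x, H σ = (h x)⁻¹ * h (D σ x)) ∧
      (∀ a σ, H (inducedMap α hx a σ) = H σ) ∧
      (∃ Hbar : FundamentalGroup M (p x') ⧸ displacementSubgroup (inducedMap α hx) →*
          Diff (𝓡 q) n N,
        ∀ σ : FundamentalGroup M (p x'), Hbar (QuotientGroup.mk σ) = H σ) ∧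
      (displacementSubgroup (inducedMap α hx)).FiniteIndex := by
  have : LocallyPathConnectedSpace M :=
    ChartedSpace.locallyPathConnectedSpace (EuclideanSpace ℝ (Fin m)) M
  have : LocallyPathConnectedSpace M' :=
    locallyPathConnectedSpace_of_isLocalHomeomorph hp.isLocalHomeomorph
  obtain ⟨Θ⟩ := hW.nonempty_leafTransport hn hp.continuous
  choose D hD using fun σ : FundamentalGroup M (p x') =>
    exists_deckTransformation hp (hp.monodromy σ ⟨x', rfl⟩).2
  have hfix (a) (y : N) : extension α β a (p x', y) = (p x', y) :=
    Prod.ext (hx a) (by simp [extension, hβx])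
  have hinv (a σ) : Θ.holonomy hW hn hp x' (inducedMap α hx a σ) = Θ.holonomy hW hn hp x' σ :=
    Θ.holonomy_mapOfEq hW hn hp (hx a) (contMDiff_extension hβ a) (hW_inv a) (fun _ => rfl)
      (hfix a) σ
  obtain ⟨a, ha_affine, ha_anosov⟩ := hα
  exact ⟨Θ.toDiff x', D, Θ.holonomy hW hn hp x', Θ.liftedLeaf_inter hW hn hp.continuous x', hD,
    fun σ => Θ.holonomy_eq_inv_mul hW hn hp (hD σ), hinv,
    ⟨QuotientGroup.lift _ _ (displacementSubgroup_le_ker hinv), fun _ => rfl⟩,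
    finiteIndex_displacementSubgroup_of_isAnosov α ha_affine ha_anosov hx⟩

theorem mainTheorem7 {k m q : ℕ}
    -- compact connected smooth manifolds `M`, `N`, and `M` is an infranilmanifold
    {M : Type*} [TopologicalSpace M] [ChartedSpace (EuclideanSpace ℝ (Fin m)) M]
    [IsManifold (𝓡 m) ∞ M] [T2Space M] [CompactSpace M] [ConnectedSpace M]
    {N : Type*} [TopologicalSpace N] [ChartedSpace (EuclideanSpace ℝ (Fin q)) N]
    [IsManifold (𝓡 q) ∞ N] [T2Space N] [CompactSpace N] [ConnectedSpace N]
    (hM : IsInfranilmanifold m M)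
    -- an Anosov action of `ℤ^k` on `M` by affine automorphisms
    (α : IntLattice k →* Diff (𝓡 m) ∞ M)
    (hα_affine : ∀ a, IsAffineAutomorphism m (α a).1)
    (hα_anosov : ∃ a, IsAnosov (m := m) (α a).1)
    -- the universal covering of `M`, with a base point over a fixed point of the action
    {M' : Type*} [TopologicalSpace M'] [SimplyConnectedSpace M']
    (p : M' → M) (hp : IsCoveringMap p) (x' : M') (hx : ∀ a, (α a).1 (p x') = p x')
    -- a cocycle over the action that is trivial at the fixed point
    (β : IntLattice k → M → Diff (𝓡 q) 1 N) (hβ : IsCocycle α β) (hβx : ∀ a, β a (p x') = 1)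
    -- the horizontal foliation, invariant under the extended action
    (n : ℕ∞) (hn : 1 ≤ n) (W : Foliation ((𝓡 m).prod (𝓡 q)) n m q (M × N))
    (hW : W.IsHorizontal) (hW_inv : ∀ a, W.IsInvariant (extension α β a)) :
    ∃ (h : M' → Diff (𝓡 q) n N)
      (D : FundamentalGroup M (p x') → (M' ≃ₜ M'))
      (H : FundamentalGroup M (p x') →* Diff (𝓡 q) n N),
      -- `h x y` is the point of the fiber over `x` in the lifted leaf through `(x', y)`
      (∀ x y, W.liftedLeaf p (x', y) ∩ {z | z.1 = x} = {(x, (h x).1 y)}) ∧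
      -- `D σ` is the deck transformation of `σ`, and `H` is the holonomy homomorphism
      (∀ σ, IsDeckTransformation hp x' σ (D σ)) ∧
      (∀ σ x, H σ = (h x)⁻¹ * h (D σ x)) ∧
      -- `H` is invariant and passes to the quotient
      (∀ a σ, H (inducedMap α hx a σ) = H σ) ∧
      (∃ Hbar : FundamentalGroup M (p x') ⧸ displacementSubgroup (inducedMap α hx) →*
          Diff (𝓡 q) n N,
        ∀ σ : FundamentalGroup M (p x'), Hbar (QuotientGroup.mk σ) = H σ) ∧
      -- finite index
      (displacementSubgroup (inducedMap α hx)).FiniteIndex := by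
  obtain ⟨a, ha⟩ := hα_anosov
  exact mainTheorem7_general α ⟨a, hα_affine a, ha⟩ p hp x' hx β hβ hβx n hn W hW hW_inv
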